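/- Let $k$ be a field, $V$ a finite-dimensional $k$-vector space, $T(V)$ its tensor algebra with components $V^{(n)}=V^{\otimes n}$, and $S\subseteq\mathbb{N}_{\ge 2}$ a finite set. Unadorned tensor products are over $k$. Let $R=\bigoplus_{s\in S}R_s$ with subspaces $R_s\subseteq V^{(s)}$ satisfying the minimality condition $$R_s\cap\sum_{t\in S,\ t<s}\ \sum_{j=0}^{s-t}V^{(j)}\otimes R_t\otimes V^{(s-t-j)}=0\qquad(s\in S).$$ Put $A=T(V)/\langle R\rangle$ (an $S$-multi-homogeneous algebra) and $A^s=T(V)/\langle R_s\rangle$ for $s\in S$, where $\langle\cdot\rangle$ denotes the two-sided ideal generated. For $s\in S$ let $n_s(2l)=sl$, $n_s(2l+1)=sl+1$, and let $J_0^s=k$, $J_1^s=V$, $J_i^s=\bigcap_{j=0}^{n_s(i)-s}V^{(j)}\otimes R_s\otimes V^{(n_s(i)-s-j)}$ for $i\ge 2$; put $J_0=k$, $J_1=V$ and $J_i=\bigoplus_{s\in S}J_i^s$ for $i\ge2$, so that $J_2=R$. The (left) multi-Koszul complex of $A$ is the complex of left $A$-modules $$\cdots\to A\otimes J_3\xrightarrow{\delta_3}A\otimes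 R\xrightarrow{\delta_2}A\otimes V\xrightarrow{\delta_1}A\to0,$$ where $\delta_1$ is given by multiplication and, for $i\ge2$, $\delta_i$ is the restriction to each $A\otimes J_i^s$, $s\in S$, of the map $$\alpha\otimes v_1\cdots v_{n_s(i)}\mapsto\begin{cases}\alpha v_1\cdots v_{s-1}\otimes v_s\cdots v_{n_s(i)},& i\text{ even},\\ \alpha v_1\otimes v_2\cdots v_{n_s(i)},& i\text{ odd}.\end{cases}$$ The algebra $A$ is called multi-Koszul if this complex, augmented by the canonical map $A\to k$, is a resolution of the trivial left $A$-module $k$, i.e. is exact. The algebra $A^s$ is called $s$-Koszul if its (left) Koszul complex $(A^s\otimes J^s_\bullet,\delta_\bullet)$, with $\delta_1$ given by multiplication and $\delta_i$ ($i\ge 2$) by the same formulas, augmented by $A^s\to k$, is exact. **Theorem.** The following conditions are equivalent: (i) $A$ is multi-Koszul. (ii) For each $s\in S$ the algebra $A^s$ is $s$-Koszul and the projective dimension of $A$ as a right $A^s$-module (via the canonical projection $A^s\to A$) is at most $1$; moreover $$\operatorname{Ker}(\delta_2)=\bigoplus_{s\in S}\bigl(\operatorname{Ker}(\delta_2)\cap(A\otimes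 R_s)\bigr),$$ where $\delta_2:A\otimes R\to A\otimes V$ is the second differential of the left multi-Koszul complex of $A$. -/

import Mathlib

open scoped TensorProduct DirectSum

noncomputable section

namespace MultiKoszul

universe u v

variable (k : Type u) [Field k] (V : Type v) [AddCommGroup V] [Module k V]

/-- The tensor algebra `T(V)`. -/
abbrev T : Type max u v := TensorAlgebra k V

/-- The degree one component `V = V^(1)` of `T(V)`; the degree `n` component `V^(n)` is the
power `V1 k V ^ n`, and products of subspaces of `T(V)` such as
`V1 k V ^ i * W * V1 k V ^ j` are the subspaces written `V^(i) ⊗ W ⊗ V^(j)`. -/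
abbrev V1 : Submodule k (T k V) := LinearMap.range (TensorAlgebra.ι k : V →ₗ[k] T k V)

/-! ### Cutting a word into its first `c` letters and the remaining ones -/

/-- The action of `T(V)` on `T(V) × (T(V) ⊗ T(V))` under which a letter `v` sends
`(x, w)` to `(v x, v ⊗ x)`. -/
def cutAction : T k V →ₐ[k] Module.End k (T k V × (T k V ⊗[k] T k V)) :=
  TensorAlgebra.lift k
    { toFun := fun v =>
        ((LinearMap.mulLeft k (TensorAlgebra.ι k v)).prod
          (TensorProduct.mk k (T k V) (T k V) (TensorAlgebra.ι k v))) ∘ₗ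
          LinearMap.fst k (T k V) (T k V ⊗[k] T k V)
      map_add' := fun v w => by
        ext x <;> simp [add_mul]
      map_smul' := fun a v => by
        ext x <;> simp [TensorProduct.smul_tmul'] }

/-- Cutting off the first letter: `1 ↦ 0` and `v₁ v₂ ⋯ vₙ ↦ v₁ ⊗ v₂ ⋯ vₙ`. -/
def cutFirst : T k V →ₗ[k] T k V ⊗[k] T k V :=
  LinearMap.snd k _ _ ∘ₗ
    LinearMap.applyₗ ((1, 0) : T k V × (T k V ⊗[k] T k V)) ∘ₗ (cutAction k V).toLinearMap

/-- Cutting off the first `c` letters: `v₁ ⋯ vₙ ↦ v₁ ⋯ v_c ⊗ v_{c+1} ⋯ vₙ` for `c ≤ n`. -/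
def cut : ℕ → (T k V →ₗ[k] T k V ⊗[k] T k V)
  | 0 => TensorProduct.mk k (T k V) (T k V) 1
  | c + 1 =>
      LinearMap.rTensor (T k V) (LinearMap.mul' k (T k V)) ∘ₗ
        (TensorProduct.assoc k (T k V) (T k V) (T k V)).symm.toLinearMap ∘ₗ
        LinearMap.lTensor (T k V) (cut c) ∘ₗ cutFirst k V

variable {k V}

theorem cutAction_ι (v : V) (p : T k V × (T k V ⊗[k] T k V)) :
    cutAction k V (TensorAlgebra.ι k v) p =
      (TensorAlgebra.ι k v * p.1, TensorAlgebra.ι k v ⊗ₜ[k] p.1) := by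
  simp [cutAction]

theorem cutAction_fst (x : T k V) (p : T k V × (T k V ⊗[k] T k V)) :
    (cutAction k V x p).1 = x * p.1 := by
  induction x using TensorAlgebra.induction generalizing p with
  | algebraMap r => simp [Algebra.smul_def, Module.algebraMap_end_apply]
  | ι v => simp [cutAction_ι]
  | mul a b ha hb => simp [ha, hb, mul_assoc]
  | add a b ha hb => simp [ha, hb, add_mul]

theorem cutFirst_ι_mul (v : V) (x : T k V) :
    cutFirst k V (TensorAlgebra.ι k v * x) = TensorAlgebra.ι k v ⊗ₜ[k] x := by
  simp [cutFirst, cutAction_ι, cutAction_fst]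

theorem cut_succ_ι_mul (c : ℕ) (v : V) (x : T k V) :
    cut k V (c + 1) (TensorAlgebra.ι k v * x) =
      LinearMap.rTensor (T k V) (LinearMap.mulLeft k (TensorAlgebra.ι k v)) (cut k V c x) := by
  simp only [cut, LinearMap.comp_apply, cutFirst_ι_mul, LinearMap.lTensor_tmul]
  induction cut k V c x using TensorProduct.induction_on with
  | zero => simp
  | tmul a b => simp
  | add a b ha hb => simp only [TensorProduct.tmul_add, map_add, ha, hb]

/-- The defining formula of `cut` on words. -/
theorem cut_word (l l' : List V) :
    cut k V l.length ((l.map (TensorAlgebra.ι k)).prod * (l'.map (TensorAlgebra.ι k)).prod) =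
      (l.map (TensorAlgebra.ι k)).prod ⊗ₜ[k] (l'.map (TensorAlgebra.ι k)).prod := by
  induction l with
  | nil => simp [cut]
  | cons v l ih => simp [mul_assoc, cut_succ_ι_mul, ih]

theorem cut_mul_of_mem (c : ℕ) {x : T k V} (hx : x ∈ V1 k V ^ c) (y : T k V) :
    cut k V c (x * y) = x ⊗ₜ[k] y := by
  induction c generalizing x with
  | zero =>
    rw [pow_zero, Submodule.mem_one] at hx
    obtain ⟨r, rfl⟩ := hx
    simp [cut, Algebra.algebraMap_eq_smul_one, TensorProduct.smul_tmul']
  | succ c ih =>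
    rw [pow_succ'] at hx
    induction hx using Submodule.mul_induction_on' with
    | mem_mul_mem a ha b hb =>
      obtain ⟨v, rfl⟩ := ha
      rw [mul_assoc, cut_succ_ι_mul, ih hb]
      simp
    | add a _ b _ ha hb => rw [add_mul, map_add, ha, hb, TensorProduct.add_tmul]

/-- The inclusion `M ⊗ X → M ⊗ T(V)` for a subspace `X` of `T(V)`. -/
abbrev inclT (M : Type*) [AddCommGroup M] [Module k M] (X : Submodule k (T k V)) :
    M ⊗[k] X →ₗ[k] M ⊗[k] T k V :=
  LinearMap.lTensor M X.subtype

theorem inclT_injective (M : Type*) [AddCommGroup M] [Module k M] (X : Submodule k (T k V)) :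
    Function.Injective (inclT M X) :=
  Module.Flat.lTensor_preserves_injective_linearMap _ X.injective_subtype

theorem cut_mem_range (c : ℕ) (X : Submodule k (T k V)) {x : T k V}
    (hx : x ∈ V1 k V ^ c * X) : cut k V c x ∈ LinearMap.range (inclT (T k V) X) := by
  induction hx using Submodule.mul_induction_on' with
  | mem_mul_mem a ha b hb =>
    rw [cut_mul_of_mem c ha]
    exact ⟨a ⊗ₜ ⟨b, hb⟩, by simp⟩
  | add a _ b _ ha hb => rw [map_add]; exact Submodule.add_mem _ ha hb

theorem mem_range_inclT_iff {ι : Type*} [DecidableEq ι] (M : Type*) [AddCommGroup M] [Module k M]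
    (b : Module.Basis ι k M) (X : Submodule k (T k V)) (z : M ⊗[k] T k V) :
    z ∈ LinearMap.range (inclT M X) ↔
      ∀ i, TensorProduct.equivFinsuppOfBasisLeft b z i ∈ X := by
  constructor
  · rintro ⟨y, rfl⟩ i
    induction y using TensorProduct.induction_on with
    | zero => simp
    | tmul m x =>
      simpa [TensorProduct.equivFinsuppOfBasisLeft_apply_tmul_apply] using
        X.smul_mem _ x.2
    | add a b ha hb => simpa using X.add_mem ha hb
  · intro h
    rw [← (TensorProduct.equivFinsuppOfBasisLeft b).symm_apply_apply z,
      TensorProduct.equivFinsuppOfBasisLeft_symm_apply]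
    refine Submodule.sum_mem _ fun i _ => ⟨b i ⊗ₜ ⟨_, h i⟩, by simp⟩

theorem mem_range_inclT_iInf {J : Type*} (M : Type*) [AddCommGroup M] [Module k M]
    (X : J → Submodule k (T k V)) (z : M ⊗[k] T k V)
    (h : ∀ j, z ∈ LinearMap.range (inclT M (X j))) :
    z ∈ LinearMap.range (inclT M (⨅ j, X j)) := by
  classical
  have b := Module.Basis.ofVectorSpace k M
  rw [mem_range_inclT_iff M b]
  intro i
  rw [Submodule.mem_iInf]
  exact fun j => (mem_range_inclT_iff M b _ _).1 (h j) i

/-! ### The spaces `J_i^s` -/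

/-- The function `n_s`: `n_s(2l) = s l` and `n_s(2l+1) = s l + 1`. -/
def jump (s i : ℕ) : ℕ := s * (i / 2) + i % 2

/-- The number of letters that the `i`-th differential moves to the left. -/
def cutLen (s i : ℕ) : ℕ := if Even i then s - 1 else 1

/-- The spaces `J_i^s`, where `R` is a subspace of `V^(s)`: `J_0^s = k`, `J_1^s = V` and
`J_i^s = ⋂_{0 ≤ j ≤ n_s(i) - s} V^(j) ⊗ R ⊗ V^(n_s(i) - s - j)` for `i ≥ 2`. -/
def J (s : ℕ) (R : Submodule k (T k V)) : ℕ → Submodule k (T k V)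
  | 0 => 1
  | 1 => V1 k V
  | i + 2 => ⨅ j : Fin (jump s (i + 2) - s + 1),
      V1 k V ^ (j : ℕ) * R * V1 k V ^ (jump s (i + 2) - s - j)

theorem jump_add_two (s i : ℕ) : jump s (i + 2) = jump s i + s := by
  have h : (i + 2) / 2 = i / 2 + 1 := by omega
  simp only [jump, Nat.add_mod_right, h]
  ring

theorem jump_succ {s : ℕ} (hs : 2 ≤ s) (i : ℕ) :
    jump s (i + 1) = jump s i + cutLen s (i + 1) := by
  induction i using Nat.twoStepInduction with
  | zero => simp [jump, cutLen]
  | one => simp [jump, cutLen]; omega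
  | more i ih _ =>
    rw [show i + 2 + 1 = i + 1 + 2 from rfl, jump_add_two, jump_add_two, ih]
    have : cutLen s (i + 1 + 2) = cutLen s (i + 1) := by simp [cutLen, Nat.even_add]
    omega

theorem J_two (s : ℕ) (R : Submodule k (T k V)) : J s R 2 = R := by
  have : jump s 2 - s = 0 := by simp [jump]
  simp only [J]
  refine le_antisymm ((iInf_le _ 0).trans ?_) (le_iInf fun j => ?_)
  · simp [this]
  · have h0 : (j : ℕ) = 0 := by have := j.2; simp only [zero_add] at this; omega
    simp [h0, this]

theorem cut_J_mem {s : ℕ} (hs : 2 ≤ s) {R : Submodule k (T k V)} (hR : R ≤ V1 k V ^ s)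
    (i : ℕ) {x : T k V} (hx : x ∈ J s R (i + 2)) :
    cut k V (cutLen s (i + 2)) x ∈ LinearMap.range (inclT (T k V) (J s R (i + 1))) := by
  rcases i with _ | i
  · refine cut_mem_range _ _ ?_
    have hx' : x ∈ V1 k V ^ s := hR (by rwa [J_two] at hx)
    have : cutLen s (0 + 2) + 1 = s := by simp [cutLen]; omega
    change x ∈ V1 k V ^ cutLen s (0 + 2) * V1 k V
    rwa [← pow_succ, this]
  · have h1 : jump s (i + 1 + 2) = jump s (i + 2) + cutLen s (i + 1 + 2) := jump_succ hs (i + 2)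
    have h2 : s ≤ jump s (i + 2) := by rw [jump_add_two]; omega
    refine mem_range_inclT_iInf _ _ _ fun j => cut_mem_range _ _ ?_
    have hj := j.2
    rw [J, Submodule.mem_iInf] at hx
    have := hx ⟨cutLen s (i + 1 + 2) + j, by omega⟩
    rw [← mul_assoc, ← mul_assoc, ← pow_add]
    convert this using 3
    simp only
    omega

/-- The restriction `J_{i+2}^s → T(V) ⊗ J_{i+1}^s` of `cut`, cutting off the first `s - 1` letters
if `i` is even and the first letter if `i` is odd. -/
def cutJ {s : ℕ} (hs : 2 ≤ s) {R : Submodule k (T k V)} (hR : R ≤ V1 k V ^ s) (i : ℕ) :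
    J s R (i + 2) →ₗ[k] T k V ⊗[k] J s R (i + 1) :=
  (LinearEquiv.ofInjective _ (inclT_injective (T k V) (J s R (i + 1)))).symm.toLinearMap ∘ₗ
    LinearMap.codRestrict _ (cut k V (cutLen s (i + 2)) ∘ₗ (J s R (i + 2)).subtype)
      (fun x => cut_J_mem hs hR i x.2)

theorem inclT_cutJ {s : ℕ} (hs : 2 ≤ s) {R : Submodule k (T k V)} (hR : R ≤ V1 k V ^ s) (i : ℕ)
    (x : J s R (i + 2)) :
    inclT (T k V) (J s R (i + 1)) (cutJ hs hR i x) = cut k V (cutLen s (i + 2)) x := by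
  have := LinearEquiv.apply_symm_apply
    (LinearEquiv.ofInjective _ (inclT_injective (T k V) (J s R (i + 1))))
    (LinearMap.codRestrict _ (cut k V (cutLen s (i + 2)) ∘ₗ (J s R (i + 2)).subtype)
      (fun x => cut_J_mem hs hR i x.2) x)
  exact congrArg Subtype.val this

/-! ### Quotient algebras of `T(V)` -/

/-- The two-sided ideal of `T(V)` generated by a set. -/
abbrev relIdeal (X : Set (T k V)) : Ideal (T k V) := (TwoSidedIdeal.span X).asIdeal

/-- The algebra `T(V)/⟨X⟩`. -/
def QuotAlg (X : Set (T k V)) : Type max u v := T k V ⧸ relIdeal X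

instance (X : Set (T k V)) : Ring (QuotAlg X) := inferInstanceAs (Ring (T k V ⧸ relIdeal X))

instance (X : Set (T k V)) : Algebra k (QuotAlg X) :=
  inferInstanceAs (Algebra k (T k V ⧸ relIdeal X))

/-- The projection `T(V) → T(V)/⟨X⟩`. -/
def QuotAlg.proj (X : Set (T k V)) : T k V →ₐ[k] QuotAlg X :=
  Ideal.Quotient.mkₐ k (relIdeal X)

theorem relIdeal_mono {X Y : Set (T k V)} (h : X ⊆ Y) : relIdeal X ≤ relIdeal Y :=
  TwoSidedIdeal.asIdeal.monotone (TwoSidedIdeal.span_mono h)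

/-- The canonical morphism `T(V)/⟨X⟩ → T(V)/⟨Y⟩` for `X ⊆ Y`. -/
def QuotAlg.map {X Y : Set (T k V)} (h : X ⊆ Y) : QuotAlg X →ₐ[k] QuotAlg Y :=
  Ideal.Quotient.factorₐ k (relIdeal_mono h)

theorem algebraMapInv_eq_zero {n : ℕ} (hn : 1 ≤ n) {x : T k V} (hx : x ∈ V1 k V ^ n) :
    TensorAlgebra.algebraMapInv x = 0 := by
  obtain ⟨n, rfl⟩ := Nat.exists_eq_add_of_le' hn
  rw [pow_succ'] at hx
  induction hx using Submodule.mul_induction_on' with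
  | mem_mul_mem a ha b hb =>
    obtain ⟨v, rfl⟩ := ha
    simp [TensorAlgebra.algebraMapInv]
  | add a _ b _ ha hb => rw [map_add, ha, hb, add_zero]

/-- The augmentation `T(V)/⟨X⟩ → k`, sending the elements of `V` to `0`, for a set `X` of elements
without constant term. -/
def QuotAlg.aug (X : Set (T k V)) (hX : ∀ x ∈ X, TensorAlgebra.algebraMapInv x = 0) :
    QuotAlg X →ₐ[k] k :=
  Ideal.Quotient.liftₐ (relIdeal X) TensorAlgebra.algebraMapInv (fun a ha => by
    have h : TwoSidedIdeal.span X ≤ TwoSidedIdeal.ker (TensorAlgebra.algebraMapInv (R := k) (M := V)) :=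
      TwoSidedIdeal.span_le.2 fun x hx => (TwoSidedIdeal.mem_ker _).2 (hX x hx)
    exact (TwoSidedIdeal.mem_ker _).1 (h (TwoSidedIdeal.mem_asIdeal.1 ha)))

/-- The `A`-linear extension `A ⊗ M → P`, `α ⊗ m ↦ α • f m`, of a `k`-linear map `f : M → P` to an
`A`-module. -/
def extendLeft {A M P : Type*} [Ring A] [Algebra k A] [AddCommMonoid M] [Module k M]
    [AddCommMonoid P] [Module k P] [Module A P] [IsScalarTower k A P] (f : M →ₗ[k] P) :
    A ⊗[k] M →ₗ[A] P :=
  TensorProduct.AlgebraTensorModule.lift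
    { toFun := fun a => a • f
      map_add' := fun a b => add_smul a b f
      map_smul' := fun a b => mul_smul a b f }

/-! ### The differentials -/

/-- The differential `δ₁ : A ⊗ V → A` given by multiplication, for `A = T(V)/⟨X⟩`. -/
def diffOne (X : Set (T k V)) : QuotAlg X ⊗[k] V1 k V →ₗ[QuotAlg X] QuotAlg X :=
  extendLeft ((QuotAlg.proj X).toLinearMap ∘ₗ (V1 k V).subtype)

/-- The map `J_{i+2}^s → A ⊗ J_{i+1}^s`, the restriction to `1 ⊗ J_{i+2}^s` of `δ_{i+2}`, for
`A = T(V)/⟨X⟩`. -/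
def cutJA (X : Set (T k V)) {s : ℕ} (hs : 2 ≤ s) {R : Submodule k (T k V)}
    (hR : R ≤ V1 k V ^ s) (i : ℕ) : J s R (i + 2) →ₗ[k] QuotAlg X ⊗[k] J s R (i + 1) :=
  LinearMap.rTensor (J s R (i + 1)) (QuotAlg.proj X).toLinearMap ∘ₗ cutJ hs hR i

/-- The case `i = 0` of `cutJA`: the map `J_2^s → A ⊗ V` (where `J_2^s = R` and `J_1^s = V`),
`v₁ ⋯ v_s ↦ v₁ ⋯ v_{s-1} ⊗ v_s`. -/
def cutVA (X : Set (T k V)) {s : ℕ} (hs : 2 ≤ s) {R : Submodule k (T k V)}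
    (hR : R ≤ V1 k V ^ s) : J s R 2 →ₗ[k] QuotAlg X ⊗[k] V1 k V :=
  cutJA X hs hR 0

/-! ### Homogeneous algebras -/

/-- The augmentation of the algebra `T(V)/⟨R⟩`, where `R ⊆ V^(s)`. -/
def homAug {s : ℕ} (hs : 2 ≤ s) {R : Submodule k (T k V)} (hR : R ≤ V1 k V ^ s) :
    QuotAlg (R : Set (T k V)) →ₐ[k] k :=
  QuotAlg.aug _ fun _ hx => algebraMapInv_eq_zero (by omega) (hR hx)

/-- The differential `A ⊗ J_2^s → A ⊗ V` of the Koszul complex of `A = T(V)/⟨R⟩`, where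
`R ⊆ V^(s)`, so that `J_2^s = R`; it moves the first `s - 1` letters to the left. -/
def homDiffTwo {s : ℕ} (hs : 2 ≤ s) {R : Submodule k (T k V)} (hR : R ≤ V1 k V ^ s) :
    QuotAlg (R : Set (T k V)) ⊗[k] J s R 2 →ₗ[QuotAlg (R : Set (T k V))]
      QuotAlg (R : Set (T k V)) ⊗[k] V1 k V :=
  extendLeft (cutVA _ hs hR)

/-- The differential `A ⊗ J_{i+3}^s → A ⊗ J_{i+2}^s` of the Koszul complex of `A = T(V)/⟨R⟩`,
where `R ⊆ V^(s)`; it moves the first letter to the left if `i` is even and the first `s - 1`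
letters if `i` is odd. -/
def homDiffHigh {s : ℕ} (hs : 2 ≤ s) {R : Submodule k (T k V)} (hR : R ≤ V1 k V ^ s) (i : ℕ) :
    QuotAlg (R : Set (T k V)) ⊗[k] J s R (i + 3) →ₗ[QuotAlg (R : Set (T k V))]
      QuotAlg (R : Set (T k V)) ⊗[k] J s R (i + 2) :=
  extendLeft (cutJA _ hs hR (i + 1))

/-- The homogeneous algebra `A = T(V)/⟨R⟩`, where `R ⊆ V^(s)`, is `s`-Koszul: its augmented (left)
Koszul complex `⋯ → A ⊗ J_3^s → A ⊗ J_2^s → A ⊗ V → A → k → 0` is exact, that is, a resolution of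
the trivial module `k` (by free modules). -/
structure IsHomogeneousKoszul {s : ℕ} (hs : 2 ≤ s) {R : Submodule k (T k V)}
    (hR : R ≤ V1 k V ^ s) : Prop where
  surjective : Function.Surjective (homAug hs hR)
  exact_zero : Function.Exact (diffOne (R : Set (T k V))) (homAug hs hR)
  exact_one : Function.Exact (homDiffTwo hs hR) (diffOne (R : Set (T k V)))
  exact_two : Function.Exact (homDiffHigh hs hR 0) (homDiffTwo hs hR)
  exact_add_three : ∀ i, Function.Exact (homDiffHigh hs hR (i + 1)) (homDiffHigh hs hR i)

/-! ### Multi-homogeneous algebras -/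

variable (k V) in
/-- A minimal space of relations `R = ⊕_{s ∈ S} R_s` with `R_s ⊆ V^(s)`, for a finite set `S` of
integers `≥ 2`: the presentation of an `S`-multi-homogeneous algebra. -/
structure RelationSpace (S : Finset ℕ) where
  R : S → Submodule k (T k V)
  two_le : ∀ s : S, 2 ≤ (s : ℕ)
  le_pow : ∀ s : S, R s ≤ V1 k V ^ (s : ℕ)
  minimal : ∀ s : S, Disjoint (R s)
    (⨆ (t : S) (_ : (t : ℕ) < s) (j : Fin ((s : ℕ) - t + 1)),
      V1 k V ^ (j : ℕ) * R t * V1 k V ^ ((s : ℕ) - t - j))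

namespace RelationSpace

variable {S : Finset ℕ} (P : RelationSpace k V S)

/-- The union of the subspaces `R_s`. -/
def relSet : Set (T k V) := ⋃ s, (P.R s : Set (T k V))

/-- The algebra `A = T(V)/⟨R⟩`. -/
abbrev Alg : Type max u v := QuotAlg P.relSet

/-- The homogeneous algebra `A^s = T(V)/⟨R_s⟩`. -/
abbrev AlgAt (s : S) : Type max u v := QuotAlg (P.R s : Set (T k V))

/-- The canonical projection `A^s → A`. -/
def algAtMap (s : S) : P.AlgAt s →ₐ[k] P.Alg :=
  QuotAlg.map (Set.subset_iUnion (fun s => (P.R s : Set (T k V))) s)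

/-- `A` as a right module over `A^s`, via the canonical projection `A^s → A`. -/
def rightModule (s : S) : ModuleCat.{max u v} (P.AlgAt s)ᵐᵒᵖ :=
  (ModuleCat.restrictScalars (P.algAtMap s).toRingHom.op).obj (ModuleCat.of P.Algᵐᵒᵖ P.Alg)

/-- The space `J_i = ⊕_{s ∈ S} J_i^s`, for `i ≥ 2`. In particular `J_2 = R`. -/
abbrev Jsum (i : ℕ) : Type max u v := ⨁ s : S, J (s : ℕ) (P.R s) i

/-- The augmentation `A → k`. -/
def aug : P.Alg →ₐ[k] k :=
  QuotAlg.aug _ fun x hx => by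
    obtain ⟨s, hs⟩ := Set.mem_iUnion.1 hx
    exact algebraMapInv_eq_zero (by have := P.two_le s; omega) (P.le_pow s hs)

/-- The differential `δ₁ : A ⊗ V → A`. -/
def δ₁ : P.Alg ⊗[k] V1 k V →ₗ[P.Alg] P.Alg := diffOne P.relSet

/-- The differential `δ₂ : A ⊗ R → A ⊗ V`, `α ⊗ v₁ ⋯ v_s ↦ α v₁ ⋯ v_{s-1} ⊗ v_s` on `A ⊗ R_s`. -/
def δ₂ : P.Alg ⊗[k] P.Jsum 2 →ₗ[P.Alg] P.Alg ⊗[k] V1 k V :=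
  extendLeft (DirectSum.toModule k S (P.Alg ⊗[k] V1 k V)
    fun s => cutVA P.relSet (P.two_le s) (P.le_pow s))

/-- The differential `δ_{i+3} : A ⊗ J_{i+3} → A ⊗ J_{i+2}`, the direct sum over `s ∈ S` of the maps
`A ⊗ J_{i+3}^s → A ⊗ J_{i+2}^s` moving the first letter (if `i` is even) or the first `s - 1`
letters (if `i` is odd) to the left. -/
def δHigh (i : ℕ) : P.Alg ⊗[k] P.Jsum (i + 3) →ₗ[P.Alg] P.Alg ⊗[k] P.Jsum (i + 2) :=
  extendLeft (DirectSum.toModule k S (P.Alg ⊗[k] P.Jsum (i + 2)) fun s =>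
    LinearMap.lTensor P.Alg
      (DirectSum.lof k S (fun s : S => J (s : ℕ) (P.R s) (i + 2)) s) ∘ₗ
      cutJA P.relSet (P.two_le s) (P.le_pow s) (i + 1))

/-- `A` is (left) multi-Koszul: its augmented left multi-Koszul complex
`⋯ → A ⊗ J_3 → A ⊗ R → A ⊗ V → A → k → 0` is exact, that is, a resolution of the trivial
module `k` (by free modules). -/
structure IsMultiKoszul : Prop where
  surjective : Function.Surjective P.aug
  exact_zero : Function.Exact P.δ₁ P.aug
  exact_one : Function.Exact P.δ₂ P.δ₁
  exact_two : Function.Exact (P.δHigh 0) P.δ₂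
  exact_add_three : ∀ i, Function.Exact (P.δHigh (i + 1)) (P.δHigh i)

/-- The submodule `A ⊗ R_s` of `A ⊗ R`. -/
def relPart (s : S) : Submodule P.Alg (P.Alg ⊗[k] P.Jsum 2) :=
  LinearMap.range (TensorProduct.AlgebraTensorModule.map
    (LinearMap.id : P.Alg →ₗ[P.Alg] P.Alg)
    (DirectSum.lof k S (fun s : S => J (s : ℕ) (P.R s) 2) s))

end RelationSpace

/-- `N` is the (internal) direct sum of the submodules `N' i`. -/
def IsDirectSumOf {A M ι : Type*} [Ring A] [AddCommGroup M] [Module A M] (N : Submodule A M)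
    (N' : ι → Submodule A M) : Prop :=
  iSupIndep N' ∧ N = ⨆ i, N' i

end MultiKoszul

end

/-!
Fix `s ∈ S`, write `Q` for the homogeneous algebra `A^s` and `K` for the kernel of the projection
`Q → A`, a graded ideal which is regarded as a right `Q`-module. Since `0 → K → Q → A → 0` is exact
and `Q` is free, `A` has projective dimension at most one if and only if `K` is projective
(`RelationSpace.hasProjectiveDimensionLE_one_iff`). Tensoring the Koszul complex of `Q` over `Q` with
`A` gives the summand `A ⊗ J_•^s` of the multi-Koszul complex. In degrees zero and one both complexes
are always exact: these degrees merely express the presentations of the algebras by generators and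
relations (`exact_diffOne_aug`, `exact_homDiffTwo_diffOne`, `RelationSpace.exact_δ₂_δ₁`).

In degrees at least two, the multi-Koszul complex is the direct sum of the complexes `A ⊗ J_•^s`,
except that the second differentials share the target `A ⊗ V`. Hence it is exact if and only if each
`A ⊗ J_•^s` is exact in degrees at least two and `ker δ₂` is the sum of its intersections with the
`A ⊗ R_s` (`RelationSpace.isMultiKoszul_iff_exact_dAt`). It remains to show, for each `s`, that
`A ⊗ J_•^s` is exact in degrees at least two if and only if `Q` is Koszul and `K` is projective.

If `Q` is Koszul and `K` is projective, hence a direct summand of a free module, then `K ⊗ J_•^s` is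
exact in positive degrees (`exists_lift_of_projective`), and the short exact sequence of complexes
`0 → K ⊗ J_•^s → Q ⊗ J_•^s → A ⊗ J_•^s → 0` yields the claim (`exact_dJ_of_projective`).

Conversely, exactness of `A ⊗ J_•^s` in degree two says that `Tor₂(A, k) = Tor₁(K, k) = 0`, in the
form that the part of the Koszul complex ending in `K ⊗ R_s → K ⊗ V → K` is exact. By a graded
Nakayama argument a minimal system `B` of homogeneous generators of `K` is then a basis
(`IsMinimalGenerators.eq_zero_of_combine_eq_zero`). A cycle of `Q ⊗ J_•^s` becomes a boundary over
`A`, so up to a boundary it lies in `K ⊗ J_•^s` and is a combination, with coefficients in `B`, of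
cycles of smaller degree; by induction it is a boundary (`IsMinimalGenerators.exists_dJ_eq`).

The grading of a quotient of `T(V)` by homogeneous relations is encoded by the algebra map `coaction`
to polynomials, `a ↦ a Xⁿ` for `a` of degree `n`.
-/

open scoped TensorProduct DirectSum

noncomputable section

namespace MultiKoszul

universe u v w

variable {k : Type u} [Field k] {V : Type v} [AddCommGroup V] [Module k V]

/-! ### The grading of a quotient of the tensor algebra -/

theorem iSup_V1_pow : ⨆ n, V1 k V ^ n = ⊤ :=
  (DirectSum.Decomposition.isInternal (fun n => V1 k V ^ n)).submodule_iSup_eq_top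

theorem QuotAlg.proj_surjective (X : Set (T k V)) : Function.Surjective (QuotAlg.proj X) :=
  Ideal.Quotient.mk_surjective

theorem QuotAlg.proj_eq_zero_iff {X : Set (T k V)} {t : T k V} :
    QuotAlg.proj X t = 0 ↔ t ∈ TwoSidedIdeal.span X :=
  (Ideal.Quotient.eq_zero_iff_mem (I := relIdeal X)).trans TwoSidedIdeal.mem_asIdeal

theorem QuotAlg.proj_of_mem {X : Set (T k V)} {t : T k V} (ht : t ∈ X) :
    QuotAlg.proj X t = 0 :=
  QuotAlg.proj_eq_zero_iff.2 (TwoSidedIdeal.subset_span ht)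

theorem QuotAlg.map_proj {X Y : Set (T k V)} (h : X ⊆ Y) (t : T k V) :
    QuotAlg.map h (QuotAlg.proj X t) = QuotAlg.proj Y t := rfl

theorem QuotAlg.map_surjective {X Y : Set (T k V)} (h : X ⊆ Y) :
    Function.Surjective (QuotAlg.map h) := fun a => by
  obtain ⟨t, rfl⟩ := QuotAlg.proj_surjective Y a
  exact ⟨QuotAlg.proj X t, rfl⟩

/-- Two linear maps on `T(V)/⟨X⟩` agree as soon as they agree on classes of homogeneous tensors. -/
theorem QuotAlg.linearMap_ext {X : Set (T k V)} {M : Type*} [AddCommGroup M] [Module k M]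
    {f g : QuotAlg X →ₗ[k] M}
    (h : ∀ n, ∀ t ∈ V1 k V ^ n, f (QuotAlg.proj X t) = g (QuotAlg.proj X t)) : f = g := by
  have key : (⊤ : Submodule k (T k V)) ≤
      LinearMap.eqLocus (f ∘ₗ (QuotAlg.proj X).toLinearMap) (g ∘ₗ (QuotAlg.proj X).toLinearMap) := by
    rw [← iSup_V1_pow]
    exact iSup_le fun n t ht => h n t ht
  ext a
  obtain ⟨t, rfl⟩ := QuotAlg.proj_surjective X a
  exact key (Submodule.mem_top (x := t))

/-- The elements of `X` are homogeneous tensors of positive degree. -/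
def IsPosHomogeneous (X : Set (T k V)) : Prop := ∀ x ∈ X, ∃ n, 1 ≤ n ∧ x ∈ V1 k V ^ n

/-- The algebra map from `T(V)` to polynomials over `T(V)/⟨X⟩` sending `v` to `v X`. -/
def tensorCoaction (X : Set (T k V)) : T k V →ₐ[k] Polynomial (QuotAlg X) :=
  TensorAlgebra.lift k
    ((Polynomial.monomial (R := QuotAlg X) 1).restrictScalars k ∘ₗ
      (QuotAlg.proj X).toLinearMap ∘ₗ TensorAlgebra.ι k)

theorem tensorCoaction_of_mem (X : Set (T k V)) {n : ℕ} {t : T k V} (ht : t ∈ V1 k V ^ n) :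
    tensorCoaction X t = Polynomial.monomial n (QuotAlg.proj X t) := by
  induction ht using Submodule.pow_induction_on_left' with
  | algebraMap r => simp [Polynomial.algebraMap_apply]
  | add x y i _ _ hx hy => simp [hx, hy]
  | mem_mul m hm i x _ hx =>
    obtain ⟨v, rfl⟩ := hm
    rw [map_mul, hx, map_mul]
    simp [tensorCoaction, Polynomial.monomial_mul_monomial, add_comm]

/-- The grading of `T(V)/⟨X⟩`, encoded as the algebra map to polynomials over `T(V)/⟨X⟩` which sends
an element `a` of degree `n` to the monomial `a Xⁿ`. -/
def coaction {X : Set (T k V)} (hX : IsPosHomogeneous X) :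
    QuotAlg X →ₐ[k] Polynomial (QuotAlg X) :=
  Ideal.Quotient.liftₐ (relIdeal X) (tensorCoaction X) (fun a ha => by
    have h : TwoSidedIdeal.span X ≤ TwoSidedIdeal.ker (tensorCoaction X) :=
      TwoSidedIdeal.span_le.2 fun x hx => (TwoSidedIdeal.mem_ker _).2 (by
        obtain ⟨n, -, hn⟩ := hX x hx
        rw [tensorCoaction_of_mem X hn, QuotAlg.proj_of_mem hx, map_zero])
    exact (TwoSidedIdeal.mem_ker _).1 (h (TwoSidedIdeal.mem_asIdeal.1 ha)))

theorem coaction_proj {X : Set (T k V)} (hX : IsPosHomogeneous X) (t : T k V) :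
    coaction hX (QuotAlg.proj X t) = tensorCoaction X t := rfl

/-- The projection of `T(V)/⟨X⟩` onto its component of degree `n`. -/
def degPart {X : Set (T k V)} (hX : IsPosHomogeneous X) (n : ℕ) : QuotAlg X →ₗ[k] QuotAlg X :=
  (Polynomial.lcoeff (QuotAlg X) n).restrictScalars k ∘ₗ (coaction hX).toLinearMap

theorem degPart_apply {X : Set (T k V)} (hX : IsPosHomogeneous X) (n : ℕ) (a : QuotAlg X) :
    degPart hX n a = (coaction hX a).coeff n := rfl

theorem degPart_proj {X : Set (T k V)} (hX : IsPosHomogeneous X) {n : ℕ} {t : T k V}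
    (ht : t ∈ V1 k V ^ n) (m : ℕ) :
    degPart hX m (QuotAlg.proj X t) = if n = m then QuotAlg.proj X t else 0 := by
  rw [degPart_apply, coaction_proj, tensorCoaction_of_mem X ht, Polynomial.coeff_monomial]

theorem degPart_degPart {X : Set (T k V)} (hX : IsPosHomogeneous X) (m n : ℕ) (a : QuotAlg X) :
    degPart hX m (degPart hX n a) = if n = m then degPart hX n a else 0 := by
  have : degPart hX m ∘ₗ degPart hX n = if n = m then degPart hX n else 0 := by
    refine QuotAlg.linearMap_ext fun i t ht => ?_
    by_cases h : i = n <;> by_cases h' : n = m <;>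
      simp [degPart_proj hX ht, h, h']
    all_goals aesop
  have := LinearMap.congr_fun this a
  rw [LinearMap.comp_apply] at this
  rw [this]
  split_ifs <;> rfl

/-- Every element is the sum of its components; the bound is uniform in `M ≥ N` so that the
statement passes to sums of elements. -/
theorem exists_sum_degPart {X : Set (T k V)} (hX : IsPosHomogeneous X) (a : QuotAlg X) :
    ∃ N, ∀ M, N ≤ M → ∑ n ∈ Finset.range M, degPart hX n a = a := by
  -- Evaluating at `X = 1` sums up the coefficients, and undoes the coaction.
  have key : ((Polynomial.lsum fun _ =>
      (LinearMap.id : QuotAlg X →ₗ[QuotAlg X] QuotAlg X)).restrictScalars k) ∘ₗ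
      (coaction hX).toLinearMap = LinearMap.id := by
    refine QuotAlg.linearMap_ext fun i t ht => ?_
    simp [coaction_proj, tensorCoaction_of_mem X ht, Polynomial.lsum_apply]
  have h := LinearMap.congr_fun key a
  refine ⟨(coaction hX a).natDegree + 1, fun M hM => ?_⟩
  conv_rhs => rw [show a = LinearMap.id (R := k) a from rfl, ← h]
  simp only [LinearMap.comp_apply, LinearMap.restrictScalars_apply, Polynomial.lsum_apply,
    AlgHom.toLinearMap_apply, LinearMap.id_coe, id_eq]
  rw [Polynomial.sum_over_range' _ (by simp) M (by omega)]
  rfl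

theorem degPart_mul_proj {X : Set (T k V)} (hX : IsPosHomogeneous X) {m : ℕ} {t : T k V}
    (ht : t ∈ V1 k V ^ m) (n : ℕ) (a : QuotAlg X) :
    degPart hX (n + m) (a * QuotAlg.proj X t) = degPart hX n a * QuotAlg.proj X t := by
  simp [degPart_apply, coaction_proj, tensorCoaction_of_mem X ht,
    ← Polynomial.C_mul_X_pow_eq_monomial, ← mul_assoc, Polynomial.coeff_mul_X_pow]

theorem degPart_mul_proj_of_lt {X : Set (T k V)} (hX : IsPosHomogeneous X) {m : ℕ} {t : T k V}
    (ht : t ∈ V1 k V ^ m) {n : ℕ} (hn : n < m) (a : QuotAlg X) :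
    degPart hX n (a * QuotAlg.proj X t) = 0 := by
  simp [degPart_apply, coaction_proj, tensorCoaction_of_mem X ht,
    ← Polynomial.C_mul_X_pow_eq_monomial, ← mul_assoc, Polynomial.coeff_mul_X_pow', hn]

/-- `b` is homogeneous of degree `d`. -/
def IsHomogeneousOfDegree {X : Set (T k V)} (hX : IsPosHomogeneous X) (d : ℕ) (b : QuotAlg X) :
    Prop :=
  coaction hX b = Polynomial.monomial d b

theorem isHomogeneousOfDegree_degPart {X : Set (T k V)} (hX : IsPosHomogeneous X) (n : ℕ)
    (a : QuotAlg X) : IsHomogeneousOfDegree hX n (degPart hX n a) := by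
  ext m
  rw [← degPart_apply, degPart_degPart, Polynomial.coeff_monomial]

theorem IsHomogeneousOfDegree.degPart {X : Set (T k V)} {hX : IsPosHomogeneous X} {d : ℕ}
    {b : QuotAlg X} (hb : IsHomogeneousOfDegree hX d b) (n : ℕ) :
    degPart hX n b = if d = n then b else 0 := by
  rw [degPart_apply, hb, Polynomial.coeff_monomial]

theorem IsHomogeneousOfDegree.degPart_mul {X : Set (T k V)} {hX : IsPosHomogeneous X} {d : ℕ}
    {b : QuotAlg X} (hb : IsHomogeneousOfDegree hX d b) (n : ℕ) (a : QuotAlg X) :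
    MultiKoszul.degPart hX n (b * a) =
      if d ≤ n then b * MultiKoszul.degPart hX (n - d) a else 0 := by
  rw [degPart_apply, map_mul, hb, ← Polynomial.C_mul_X_pow_eq_monomial, mul_assoc,
    Polynomial.X_pow_mul, Polynomial.coeff_C_mul, Polynomial.coeff_mul_X_pow']
  split_ifs
  · rfl
  · simp

/-- The canonical morphisms between quotients of `T(V)` preserve the grading. -/
theorem map_degPart {X Y : Set (T k V)} (h : X ⊆ Y) (hX : IsPosHomogeneous X)
    (hY : IsPosHomogeneous Y) (n : ℕ) (a : QuotAlg X) :
    QuotAlg.map h (degPart hX n a) = degPart hY n (QuotAlg.map h a) := by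
  have : (QuotAlg.map h).toLinearMap ∘ₗ degPart hX n =
      degPart hY n ∘ₗ (QuotAlg.map h).toLinearMap := by
    refine QuotAlg.linearMap_ext fun i t ht => ?_
    simp only [LinearMap.comp_apply, AlgHom.toLinearMap_apply, QuotAlg.map_proj,
      degPart_proj hX ht, degPart_proj hY ht]
    split_ifs
    · rfl
    · simp
  exact LinearMap.congr_fun this a

theorem isPosHomogeneous_of_le {s : ℕ} (hs : 2 ≤ s) {R : Submodule k (T k V)}
    (hR : R ≤ V1 k V ^ s) : IsPosHomogeneous (R : Set (T k V)) :=
  fun _ hx => ⟨s, by omega, hR hx⟩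

theorem RelationSpace.isPosHomogeneous_relSet {S : Finset ℕ} (P : RelationSpace k V S) :
    IsPosHomogeneous P.relSet := fun x hx => by
  obtain ⟨s, hs⟩ := Set.mem_iUnion.1 hx
  exact ⟨s, by have := P.two_le s; omega, P.le_pow s hs⟩

theorem aug_surjective (X : Set (T k V)) (hX : ∀ x ∈ X, TensorAlgebra.algebraMapInv x = 0) :
    Function.Surjective (QuotAlg.aug X hX) := fun r =>
  ⟨algebraMap k _ r, by simp⟩

theorem aug_proj (X : Set (T k V)) (hX : ∀ x ∈ X, TensorAlgebra.algebraMapInv x = 0) (t : T k V) :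
    QuotAlg.aug X hX (QuotAlg.proj X t) = TensorAlgebra.algebraMapInv t := rfl

theorem IsPosHomogeneous.algebraMapInv_eq_zero {X : Set (T k V)} (hX : IsPosHomogeneous X) :
    ∀ x ∈ X, TensorAlgebra.algebraMapInv x = 0 := fun x hx => by
  obtain ⟨n, hn, h⟩ := hX x hx
  exact MultiKoszul.algebraMapInv_eq_zero hn h

/-- The component of degree zero is the constant term. -/
theorem degPart_zero {X : Set (T k V)} (hX : IsPosHomogeneous X) (a : QuotAlg X) :
    degPart hX 0 a = algebraMap k _ (QuotAlg.aug X hX.algebraMapInv_eq_zero a) := by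
  have : degPart hX 0 = Algebra.linearMap k _ ∘ₗ
      (QuotAlg.aug X hX.algebraMapInv_eq_zero).toLinearMap := by
    refine QuotAlg.linearMap_ext fun i t ht => ?_
    simp only [LinearMap.comp_apply, AlgHom.toLinearMap_apply, degPart_proj hX ht, aug_proj]
    split_ifs with hi
    · subst hi
      rw [pow_zero, Submodule.mem_one] at ht
      obtain ⟨r, rfl⟩ := ht
      simp [TensorAlgebra.algebraMapInv]
    · rw [MultiKoszul.algebraMapInv_eq_zero (by omega) ht]; simp
  exact LinearMap.congr_fun this a

/-! ### Exactness of the Koszul complexes in degrees zero and one -/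

@[simp]
theorem extendLeft_tmul {A M P : Type*} [Ring A] [Algebra k A] [AddCommMonoid M] [Module k M]
    [AddCommMonoid P] [Module k P] [Module A P] [IsScalarTower k A P] (f : M →ₗ[k] P) (a : A)
    (m : M) : extendLeft f (a ⊗ₜ[k] m) = a • f m := by
  simp [extendLeft]

theorem diffOne_tmul (X : Set (T k V)) (a : QuotAlg X) (v : V1 k V) :
    diffOne X (a ⊗ₜ v) = a * QuotAlg.proj X v := by
  simp [diffOne]

/-- The right action of `T(V)` on `T(V) × (T(V) ⊗ V)` under which a letter `v` sends
`(x, w)` to `(x v, x ⊗ v)`. -/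
def cutLastAction : T k V →ₐ[k] (Module.End k (T k V × (T k V ⊗[k] V1 k V)))ᵐᵒᵖ :=
  TensorAlgebra.lift k
    { toFun := fun v => MulOpposite.op
        (((LinearMap.mulRight k (TensorAlgebra.ι k v)).prod
          ((TensorProduct.mk k (T k V) (V1 k V)).flip ⟨TensorAlgebra.ι k v, v, rfl⟩)) ∘ₗ
          LinearMap.fst k (T k V) (T k V ⊗[k] V1 k V))
      map_add' := fun v w => by
        rw [← MulOpposite.op_add]
        congr 1
        refine LinearMap.ext fun p => ?_
        refine Prod.ext ?_ ?_
        · simp [mul_add]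
        · simp [← TensorProduct.tmul_add]
          rfl
      map_smul' := fun a v => by
        rw [RingHom.id_apply, ← MulOpposite.op_smul]
        congr 1
        refine LinearMap.ext fun p => ?_
        refine Prod.ext ?_ ?_
        · simp
        · simp [← TensorProduct.tmul_smul]
          rfl }

/-- Cutting off the last letter: `1 ↦ 0` and `v₁ ⋯ vₙ ↦ v₁ ⋯ vₙ₋₁ ⊗ vₙ`. -/
def cutLast : T k V →ₗ[k] T k V ⊗[k] V1 k V :=
  LinearMap.snd k _ _ ∘ₗ
    LinearMap.applyₗ ((1, 0) : T k V × (T k V ⊗[k] V1 k V)) ∘ₗ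
      (MulOpposite.opLinearEquiv k).symm.toLinearMap ∘ₗ (cutLastAction (k := k) (V := V)).toLinearMap

theorem cutLastAction_ι (v : V) (p : T k V × (T k V ⊗[k] V1 k V)) :
    (cutLastAction (TensorAlgebra.ι k v)).unop p =
      (p.1 * TensorAlgebra.ι k v, p.1 ⊗ₜ[k] ⟨TensorAlgebra.ι k v, v, rfl⟩) := by
  simp [cutLastAction]

theorem cutLastAction_fst (x : T k V) (p : T k V × (T k V ⊗[k] V1 k V)) :
    ((cutLastAction x).unop p).1 = p.1 * x := by
  induction x using TensorAlgebra.induction generalizing p with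
  | algebraMap r =>
    simp [Algebra.algebraMap_eq_smul_one]
  | ι v => simp [cutLastAction_ι]
  | mul a b ha hb => simp [ha, hb, mul_assoc]
  | add a b ha hb => simp [ha, hb, mul_add]

theorem cutLast_mul_letter (x : T k V) (v : V1 k V) :
    cutLast (x * (v : T k V)) = x ⊗ₜ[k] v := by
  obtain ⟨_, v, rfl⟩ := v
  simp [cutLast, cutLastAction_ι, cutLastAction_fst]

theorem cutLast_algebraMap (r : k) : cutLast (algebraMap k (T k V) r) = 0 := by
  simp [cutLast, Algebra.algebraMap_eq_smul_one]

/-- `cutLast` is a derivation with respect to left multiplication and the constant term. -/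
theorem cutLast_mul (a b : T k V) :
    cutLast (a * b) = a • cutLast b + TensorAlgebra.algebraMapInv b • cutLast a := by
  induction b using TensorAlgebra.induction generalizing a with
  | algebraMap r =>
    rw [cutLast_algebraMap, ← Algebra.commutes, ← Algebra.smul_def]
    simp [TensorAlgebra.algebraMapInv]
  | ι v =>
    have h (x : T k V) := cutLast_mul_letter x (⟨_, v, rfl⟩ : V1 k V)
    have h1 := h 1
    rw [one_mul] at h1
    simp only at h1 h
    rw [h, h1]
    simp [TensorAlgebra.algebraMapInv, TensorProduct.smul_tmul']
  | mul x y hx hy =>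
    rw [← mul_assoc, hy, hx, hy x, map_mul, smul_add, smul_add, mul_smul, mul_smul,
      smul_comm a (TensorAlgebra.algebraMapInv y), add_assoc,
      smul_comm (TensorAlgebra.algebraMapInv x)]
  | add x y hx hy =>
    rw [mul_add, map_add, hx, hy, map_add, map_add, smul_add, add_smul]
    abel

/-- Multiplication `T(V) ⊗ V → T(V)`. -/
def mulLetter : T k V ⊗[k] V1 k V →ₗ[T k V] T k V := extendLeft (V1 k V).subtype

theorem mulLetter_tmul (a : T k V) (v : V1 k V) : mulLetter (a ⊗ₜ[k] v) = a * v := by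
  simp [mulLetter]

theorem cutLast_mulLetter (z : T k V ⊗[k] V1 k V) : cutLast (mulLetter z) = z := by
  induction z using TensorProduct.induction_on with
  | zero => simp
  | tmul x v => rw [mulLetter_tmul, cutLast_mul_letter]
  | add x y hx hy => rw [map_add, map_add, hx, hy]

theorem mulLetter_cutLast (t : T k V) :
    mulLetter (cutLast t) = t - algebraMap k _ (TensorAlgebra.algebraMapInv t) := by
  induction t using TensorAlgebra.induction with
  | algebraMap r => simp [cutLast_algebraMap, TensorAlgebra.algebraMapInv]
  | ι v =>
    have h := cutLast_mul_letter 1 (⟨_, v, rfl⟩ : V1 k V)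
    rw [one_mul] at h
    rw [h, mulLetter_tmul]
    simp [TensorAlgebra.algebraMapInv]
  | mul x y hx hy =>
    rw [cutLast_mul, map_add, map_smul, hy, LinearMap.map_smul_of_tower, hx, map_mul, map_mul,
      smul_eq_mul, mul_sub, smul_sub, Algebra.smul_def, Algebra.smul_def, Algebra.commutes _ x,
      ← map_mul, mul_comm, map_mul]
    abel
  | add x y hx hy => rw [map_add, map_add, hx, hy, map_add, map_add]; abel

theorem diffOne_rTensor_proj (X : Set (T k V)) (z : T k V ⊗[k] V1 k V) :
    diffOne X (LinearMap.rTensor _ (QuotAlg.proj X).toLinearMap z) =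
      QuotAlg.proj X (mulLetter z) := by
  induction z using TensorProduct.induction_on with
  | zero => simp
  | tmul x v => simp [mulLetter_tmul, diffOne_tmul]
  | add x y hx hy => simp only [map_add, hx, hy]

/-- Every element of `T(V)/⟨X⟩` is the sum of a constant and a multiple of letters. -/
theorem exists_diffOne_eq_sub_aug {X : Set (T k V)}
    (hX : ∀ x ∈ X, TensorAlgebra.algebraMapInv x = 0) (a : QuotAlg X) :
    ∃ w, diffOne X w = a - algebraMap k _ (QuotAlg.aug X hX a) := by
  obtain ⟨t, rfl⟩ := QuotAlg.proj_surjective X a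
  refine ⟨LinearMap.rTensor _ (QuotAlg.proj X).toLinearMap (cutLast t), ?_⟩
  rw [diffOne_rTensor_proj, mulLetter_cutLast, map_sub, AlgHom.commutes, aug_proj]

theorem aug_diffOne {X : Set (T k V)} (hX : ∀ x ∈ X, TensorAlgebra.algebraMapInv x = 0)
    (w : QuotAlg X ⊗[k] V1 k V) : QuotAlg.aug X hX (diffOne X w) = 0 := by
  induction w using TensorProduct.induction_on with
  | zero => simp
  | tmul x v =>
    rw [diffOne_tmul, map_mul, aug_proj, algebraMapInv_eq_zero (n := 1) le_rfl (by simp), mul_zero]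
  | add x y hx hy => rw [map_add, map_add, hx, hy, add_zero]

theorem exact_diffOne_aug {X : Set (T k V)} (hX : ∀ x ∈ X, TensorAlgebra.algebraMapInv x = 0) :
    Function.Exact (diffOne X) (QuotAlg.aug X hX) := fun a => by
  constructor
  · intro h
    obtain ⟨w, hw⟩ := exists_diffOne_eq_sub_aug hX a
    exact ⟨w, by rw [hw, h, map_zero, sub_zero]⟩
  · rintro ⟨w, rfl⟩
    exact aug_diffOne hX w

/-- The kernel of multiplication `A ⊗ V → A` is generated by the relations, with their last letter
cut off. -/
theorem mem_of_diffOne_eq_zero {X : Set (T k V)}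
    (hX : ∀ x ∈ X, TensorAlgebra.algebraMapInv x = 0)
    (N : Submodule (QuotAlg X) (QuotAlg X ⊗[k] V1 k V))
    (hN : ∀ x ∈ X, LinearMap.rTensor _ (QuotAlg.proj X).toLinearMap (cutLast x) ∈ N)
    {z : QuotAlg X ⊗[k] V1 k V} (hz : diffOne X z = 0) : z ∈ N := by
  have hsmul (a : T k V) (w : T k V ⊗[k] V1 k V) :
      LinearMap.rTensor _ (QuotAlg.proj X).toLinearMap (a • w) =
        QuotAlg.proj X a • LinearMap.rTensor _ (QuotAlg.proj X).toLinearMap w := by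
    induction w using TensorProduct.induction_on with
    | zero => simp
    | tmul x v => simp [TensorProduct.smul_tmul']
    | add x y hx hy => simp only [smul_add, map_add, hx, hy]
  have hsmul' (a : k) (w : QuotAlg X ⊗[k] V1 k V) (hw : w ∈ N) : a • w ∈ N := by
    rw [← algebraMap_smul (QuotAlg X) a w]
    exact N.smul_mem _ hw
  -- Multiplying a relation from the right by a letter leaves a multiple of the relation to the left
  -- of the tensor sign, which vanishes in the quotient; only left multiples of relations matter.
  have key {t : T k V} (ht : t ∈ TwoSidedIdeal.span X) :
      LinearMap.rTensor _ (QuotAlg.proj X).toLinearMap (cutLast t) ∈ N := by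
    induction ht using TwoSidedIdeal.span_induction with
    | mem x h => exact hN x h
    | zero => simp
    | add x y _ _ hx hy => rw [map_add, map_add]; exact N.add_mem hx hy
    | neg x _ hx => rw [map_neg, map_neg]; exact N.neg_mem hx
    | left_absorb a x hx h =>
      have h0 : TensorAlgebra.algebraMapInv x = 0 := by
        rw [← aug_proj X hX, QuotAlg.proj_eq_zero_iff.2 hx, map_zero]
      rw [cutLast_mul, h0, zero_smul, add_zero, hsmul]
      exact N.smul_mem _ h
    | right_absorb b x hx h =>
      rw [cutLast_mul, map_add, hsmul, QuotAlg.proj_eq_zero_iff.2 hx, zero_smul, zero_add, map_smul]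
      exact hsmul' _ _ h
  obtain ⟨w, rfl⟩ := LinearMap.rTensor_surjective (V1 k V)
    (g := (QuotAlg.proj X).toLinearMap) (QuotAlg.proj_surjective X) z
  rw [diffOne_rTensor_proj, QuotAlg.proj_eq_zero_iff] at hz
  simpa only [cutLast_mulLetter] using key hz

theorem cut_eq_inclT_cutLast {c : ℕ} {x : T k V} (hx : x ∈ V1 k V ^ (c + 1)) :
    cut k V c x = inclT (T k V) (V1 k V) (cutLast x) := by
  rw [pow_succ] at hx
  induction hx using Submodule.mul_induction_on' with
  | mem_mul_mem a ha b hb =>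
    rw [cut_mul_of_mem c ha, cutLast_mul_letter a ⟨b, hb⟩]
    simp
  | add a _ b _ ha hb => rw [map_add, map_add, map_add, ha, hb]

/-- Cutting off the first `s - 1` letters of a word of length `s` is cutting off its last letter. -/
theorem cutJ_zero {s : ℕ} (hs : 2 ≤ s) {R : Submodule k (T k V)} (hR : R ≤ V1 k V ^ s)
    (x : J s R 2) : cutJ hs hR 0 x = cutLast (x : T k V) := by
  refine inclT_injective (T k V) (V1 k V) ((inclT_cutJ hs hR 0 x).trans ?_)
  have hx : (x : T k V) ∈ R := by simpa only [J_two] using x.2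
  refine cut_eq_inclT_cutLast ?_
  have : cutLen s (0 + 2) + 1 = s := by simp [cutLen]; omega
  rw [this]
  exact hR hx

theorem cutVA_apply (X : Set (T k V)) {s : ℕ} (hs : 2 ≤ s) {R : Submodule k (T k V)}
    (hR : R ≤ V1 k V ^ s) (x : J s R 2) :
    cutVA X hs hR x = LinearMap.rTensor _ (QuotAlg.proj X).toLinearMap (cutLast (x : T k V)) := by
  rw [← cutJ_zero hs hR]
  rfl

theorem diffOne_cutVA (X : Set (T k V)) {s : ℕ} (hs : 2 ≤ s) {R : Submodule k (T k V)}
    (hR : R ≤ V1 k V ^ s) (hRX : (R : Set (T k V)) ⊆ X) (x : J s R 2) :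
    diffOne X (cutVA X hs hR x) = 0 := by
  have hx : (x : T k V) ∈ R := by simpa only [J_two] using x.2
  rw [cutVA_apply, diffOne_rTensor_proj, mulLetter_cutLast,
    algebraMapInv_eq_zero (by omega) (hR hx), map_zero, sub_zero]
  exact QuotAlg.proj_of_mem (hRX hx)

theorem exact_homDiffTwo_diffOne {s : ℕ} (hs : 2 ≤ s) {R : Submodule k (T k V)}
    (hR : R ≤ V1 k V ^ s) : Function.Exact (homDiffTwo hs hR) (diffOne (R : Set (T k V))) := by
  intro z
  constructor
  · intro hz
    refine mem_of_diffOne_eq_zero (isPosHomogeneous_of_le hs hR).algebraMapInv_eq_zero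
      (LinearMap.range (homDiffTwo hs hR)) (fun x hx => ?_) hz
    refine ⟨1 ⊗ₜ ⟨x, by rwa [J_two]⟩, ?_⟩
    rw [homDiffTwo, extendLeft_tmul, one_smul, cutVA_apply]
  · rintro ⟨w, rfl⟩
    induction w using TensorProduct.induction_on with
    | zero => simp
    | tmul a x => rw [homDiffTwo, extendLeft_tmul, map_smul, diffOne_cutVA _ hs hR le_rfl, smul_zero]
    | add x y hx hy => rw [map_add, map_add, hx, hy, add_zero]

theorem RelationSpace.subset_relSet {S : Finset ℕ} (P : RelationSpace k V S) (s : S) :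
    (P.R s : Set (T k V)) ⊆ P.relSet :=
  Set.subset_iUnion (fun s => (P.R s : Set (T k V))) s

theorem RelationSpace.exact_δ₂_δ₁ {S : Finset ℕ} (P : RelationSpace k V S) :
    Function.Exact P.δ₂ P.δ₁ := by
  classical
  intro z
  constructor
  · intro hz
    refine mem_of_diffOne_eq_zero P.isPosHomogeneous_relSet.algebraMapInv_eq_zero
      (LinearMap.range P.δ₂) (fun x hx => ?_) hz
    obtain ⟨s, hs⟩ := Set.mem_iUnion.1 hx
    refine ⟨1 ⊗ₜ DirectSum.lof k S (fun s : S => J (s : ℕ) (P.R s) 2) s ⟨x, by rwa [J_two]⟩, ?_⟩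
    rw [δ₂, extendLeft_tmul, one_smul, DirectSum.toModule_lof, cutVA_apply]
  · rintro ⟨w, rfl⟩
    induction w using TensorProduct.induction_on with
    | zero => simp
    | tmul a x =>
      rw [δ₂, extendLeft_tmul, map_smul]
      induction x using DirectSum.induction_on with
      | zero => simp
      | of s x =>
        have h := DirectSum.toModule_lof k (φ := fun s : S =>
          cutVA P.relSet (P.two_le s) (P.le_pow s)) s x
        rw [DirectSum.lof_eq_of] at h
        rw [h, δ₁, diffOne_cutVA _ _ _ (P.subset_relSet s),
          smul_zero]
      | add x y hx hy => rw [map_add, map_add, smul_add, hx, hy, add_zero]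
    | add x y hx hy => rw [map_add, map_add, hx, hy, add_zero]

/-! ### The differentials between the spaces `A ⊗ J_i^s` -/

/-- The differential `A ⊗ J_{i+2}^s → A ⊗ J_{i+1}^s` for `A = T(V)/⟨X⟩`; here `J_1^s = V`. -/
def dJ (X : Set (T k V)) {s : ℕ} (hs : 2 ≤ s) {R : Submodule k (T k V)}
    (hR : R ≤ V1 k V ^ s) (i : ℕ) :
    QuotAlg X ⊗[k] J s R (i + 2) →ₗ[QuotAlg X] QuotAlg X ⊗[k] J s R (i + 1) :=
  extendLeft (cutJA X hs hR i)

theorem dJ_tmul (X : Set (T k V)) {s : ℕ} (hs : 2 ≤ s) {R : Submodule k (T k V)}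
    (hR : R ≤ V1 k V ^ s) (i : ℕ) (a : QuotAlg X) (x : J s R (i + 2)) :
    dJ X hs hR i (a ⊗ₜ x) = a • cutJA X hs hR i x :=
  extendLeft_tmul _ _ _

theorem smul_eq_rTensor_mulLeft {A M : Type*} [Ring A] [Algebra k A] [AddCommGroup M] [Module k M]
    (a : A) (z : A ⊗[k] M) : a • z = LinearMap.rTensor M (LinearMap.mulLeft k a) z := by
  induction z using TensorProduct.induction_on with
  | zero => simp
  | tmul x v => simp [TensorProduct.smul_tmul']
  | add x y hx hy => rw [smul_add, hx, hy, map_add]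

theorem lTensor_rTensor_comm {A B M N : Type*} [AddCommGroup A] [Module k A] [AddCommGroup B]
    [Module k B] [AddCommGroup M] [Module k M] [AddCommGroup N] [Module k N] (f : A →ₗ[k] B)
    (g : M →ₗ[k] N) (z : A ⊗[k] M) :
    LinearMap.lTensor B g (LinearMap.rTensor M f z) =
      LinearMap.rTensor N f (LinearMap.lTensor A g z) := by
  rw [← LinearMap.comp_apply, ← LinearMap.comp_apply, LinearMap.lTensor_comp_rTensor,
    LinearMap.rTensor_comp_lTensor]

theorem J_le_mul_top (s : ℕ) (R : Submodule k (T k V)) (i : ℕ) : J s R (i + 2) ≤ R * ⊤ := by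
  refine (iInf_le _ 0).trans ?_
  simp only [Fin.coe_ofNat_eq_mod, Nat.zero_mod, pow_zero, one_mul]
  gcongr
  exact le_top

theorem cutLen_le {s : ℕ} (hs : 2 ≤ s) (i : ℕ) : cutLen s i ≤ s := by
  unfold cutLen; split_ifs <;> omega

theorem cutLen_succ_add {s : ℕ} (hs : 2 ≤ s) (i : ℕ) : cutLen s (i + 1) + cutLen s i = s := by
  by_cases h : Even i
  · simp [cutLen, h, Nat.even_add_one]; omega
  · simp [cutLen, h, Nat.even_add_one]; omega

theorem inclT_cutJA (X : Set (T k V)) {s : ℕ} (hs : 2 ≤ s) {R : Submodule k (T k V)}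
    (hR : R ≤ V1 k V ^ s) (i : ℕ) (x : J s R (i + 2)) :
    inclT (QuotAlg X) (J s R (i + 1)) (cutJA X hs hR i x) =
      LinearMap.rTensor _ (QuotAlg.proj X).toLinearMap (cut k V (cutLen s (i + 2)) x) := by
  rw [← inclT_cutJ hs hR, cutJA, LinearMap.comp_apply, lTensor_rTensor_comm]

/-- Two linear maps on `T(V)/⟨X⟩` which agree on the component of degree `c` have the same effect
on the left factor of the image of a map which cuts off the first `c` letters. -/
theorem rTensor_cutJA_congr (X : Set (T k V)) {s : ℕ} (hs : 2 ≤ s) {R : Submodule k (T k V)}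
    (hR : R ≤ V1 k V ^ s) (i : ℕ) {M : Type*} [AddCommGroup M] [Module k M]
    {f g : QuotAlg X →ₗ[k] M}
    (h : ∀ t ∈ V1 k V ^ cutLen s (i + 2), f (QuotAlg.proj X t) = g (QuotAlg.proj X t))
    (x : J s R (i + 2)) :
    LinearMap.rTensor _ f (cutJA X hs hR i x) = LinearMap.rTensor _ g (cutJA X hs hR i x) := by
  have hincl (f : QuotAlg X →ₗ[k] M) : inclT M _ (LinearMap.rTensor _ f (cutJA X hs hR i x)) =
      LinearMap.rTensor _ f (LinearMap.rTensor _ (QuotAlg.proj X).toLinearMap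
        (cut k V (cutLen s (i + 2)) x)) := by
    rw [← inclT_cutJA X hs hR, lTensor_rTensor_comm]
  refine inclT_injective M _ ?_
  rw [hincl, hincl]
  have hx : (x : T k V) ∈ V1 k V ^ cutLen s (i + 2) * ⊤ := by
    have hle : R * ⊤ ≤ V1 k V ^ cutLen s (i + 2) * ⊤ := by
      calc R * ⊤ ≤ V1 k V ^ (cutLen s (i + 2) + (s - cutLen s (i + 2))) * ⊤ := by
            rw [Nat.add_sub_cancel' (cutLen_le hs _)]
            gcongr
        _ ≤ V1 k V ^ cutLen s (i + 2) * ⊤ := by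
            rw [pow_add, mul_assoc]
            gcongr
            exact le_top
    exact hle (J_le_mul_top s R i x.2)
  generalize (x : T k V) = y at hx
  induction hx using Submodule.mul_induction_on' with
  | mem_mul_mem a ha b hb =>
    rw [cut_mul_of_mem _ ha]
    simp [h a ha]
  | add a _ b _ ha hb => simp only [map_add, ha, hb]

theorem rTensor_map_dJ {X Y : Set (T k V)} (h : X ⊆ Y) {s : ℕ} (hs : 2 ≤ s)
    {R : Submodule k (T k V)} (hR : R ≤ V1 k V ^ s) (i : ℕ)
    (z : QuotAlg X ⊗[k] J s R (i + 2)) :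
    LinearMap.rTensor _ (QuotAlg.map h).toLinearMap (dJ X hs hR i z) =
      dJ Y hs hR i (LinearMap.rTensor _ (QuotAlg.map h).toLinearMap z) := by
  induction z using TensorProduct.induction_on with
  | zero => simp
  | tmul a x =>
    have h1 : cutJA Y hs hR i x =
        LinearMap.rTensor _ (QuotAlg.map h).toLinearMap (cutJA X hs hR i x) := by
      rw [cutJA, cutJA, LinearMap.comp_apply, LinearMap.comp_apply, ← LinearMap.rTensor_comp_apply]
      rfl
    rw [LinearMap.rTensor_tmul, dJ_tmul, dJ_tmul, h1, smul_eq_rTensor_mulLeft,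
      smul_eq_rTensor_mulLeft, ← LinearMap.rTensor_comp_apply, ← LinearMap.rTensor_comp_apply]
    congr 2
    ext b
    simp
  | add x y hx hy => simp only [map_add, hx, hy]

/-- The differential raises the degree of the left tensor factor by the number of letters which it
moves to the left. -/
theorem rTensor_degPart_dJ {X : Set (T k V)} (hX : IsPosHomogeneous X) {s : ℕ} (hs : 2 ≤ s)
    {R : Submodule k (T k V)} (hR : R ≤ V1 k V ^ s) (i n : ℕ)
    (z : QuotAlg X ⊗[k] J s R (i + 2)) :
    LinearMap.rTensor _ (degPart hX (n + cutLen s (i + 2))) (dJ X hs hR i z) =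
      dJ X hs hR i (LinearMap.rTensor _ (degPart hX n) z) := by
  induction z using TensorProduct.induction_on with
  | zero => simp
  | tmul a x =>
    rw [LinearMap.rTensor_tmul, dJ_tmul, dJ_tmul, smul_eq_rTensor_mulLeft,
      smul_eq_rTensor_mulLeft, ← LinearMap.rTensor_comp_apply]
    exact rTensor_cutJA_congr X hs hR i (fun t ht => degPart_mul_proj hX ht n a) x
  | add x y hx hy => simp only [map_add, hx, hy]

theorem rTensor_degPart_dJ_of_lt {X : Set (T k V)} (hX : IsPosHomogeneous X) {s : ℕ} (hs : 2 ≤ s)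
    {R : Submodule k (T k V)} (hR : R ≤ V1 k V ^ s) (i : ℕ) {n : ℕ} (hn : n < cutLen s (i + 2))
    (z : QuotAlg X ⊗[k] J s R (i + 2)) :
    LinearMap.rTensor _ (degPart hX n) (dJ X hs hR i z) = 0 := by
  induction z using TensorProduct.induction_on with
  | zero => simp
  | tmul a x =>
    rw [dJ_tmul, smul_eq_rTensor_mulLeft, ← LinearMap.rTensor_comp_apply,
      rTensor_cutJA_congr X hs hR i (g := 0) (fun t ht => degPart_mul_proj_of_lt hX ht hn a) x]
    simp
  | add x y hx hy => simp only [map_add, hx, hy, add_zero]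

theorem degPart_succ_diffOne {X : Set (T k V)} (hX : IsPosHomogeneous X) (n : ℕ)
    (z : QuotAlg X ⊗[k] V1 k V) :
    degPart hX (n + 1) (diffOne X z) = diffOne X (LinearMap.rTensor _ (degPart hX n) z) := by
  induction z using TensorProduct.induction_on with
  | zero => simp
  | tmul a x =>
    rw [LinearMap.rTensor_tmul, diffOne_tmul, diffOne_tmul]
    exact degPart_mul_proj hX (by simp) n a
  | add x y hx hy => simp only [map_add, hx, hy]

theorem degPart_zero_diffOne {X : Set (T k V)} (hX : IsPosHomogeneous X)
    (z : QuotAlg X ⊗[k] V1 k V) : degPart hX 0 (diffOne X z) = 0 := by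
  rw [degPart_zero, aug_diffOne, map_zero]

/-- Two consecutive differentials cut off `s` letters, which form a relation, so that their
composite vanishes. -/
theorem dJ_dJ {X : Set (T k V)} {s : ℕ} (hs : 2 ≤ s) {R : Submodule k (T k V)}
    (hR : R ≤ V1 k V ^ s) (hRX : (R : Set (T k V)) ⊆ X) (i : ℕ)
    (z : QuotAlg X ⊗[k] J s R (i + 3)) :
    dJ X hs hR i (dJ X hs hR (i + 1) z) = 0 := by
  -- Computing in `A ⊗ T(V)` instead of its subspaces, where `G c` moves `c` letters to the left.
  let G (c : ℕ) : QuotAlg X ⊗[k] T k V →ₗ[QuotAlg X] QuotAlg X ⊗[k] T k V :=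
    extendLeft (LinearMap.rTensor _ (QuotAlg.proj X).toLinearMap ∘ₗ cut k V c)
  have hG (w : QuotAlg X ⊗[k] J s R (i + 2)) :
      inclT _ _ (dJ X hs hR i w) = G (cutLen s (i + 2)) (inclT _ _ w) := by
    induction w using TensorProduct.induction_on with
    | zero => simp
    | tmul a x =>
      rw [dJ_tmul, smul_eq_rTensor_mulLeft, lTensor_rTensor_comm,
        inclT_cutJA, ← smul_eq_rTensor_mulLeft, LinearMap.lTensor_tmul]
      simp only [G, extendLeft_tmul]
      rfl
    | add x y hx hy => simp only [map_add, hx, hy]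
  have hword {r : T k V} (hr : r ∈ V1 k V ^ cutLen s (i + 3) * V1 k V ^ cutLen s (i + 2))
      (y : T k V) :
      G (cutLen s (i + 2)) (LinearMap.rTensor _ (QuotAlg.proj X).toLinearMap
        (cut k V (cutLen s (i + 3)) (r * y))) = QuotAlg.proj X r ⊗ₜ y := by
    induction hr using Submodule.mul_induction_on' with
    | mem_mul_mem a ha b hb =>
      rw [mul_assoc, cut_mul_of_mem _ ha, LinearMap.rTensor_tmul]
      simp only [G, extendLeft_tmul, LinearMap.comp_apply, cut_mul_of_mem _ hb,
        LinearMap.rTensor_tmul, TensorProduct.smul_tmul']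
      simp
    | add a _ b _ ha hb => simp only [add_mul, map_add, ha, hb, TensorProduct.add_tmul]
  have hvanish {x : T k V} (hx : x ∈ R * ⊤) :
      G (cutLen s (i + 2)) (LinearMap.rTensor _ (QuotAlg.proj X).toLinearMap
        (cut k V (cutLen s (i + 3)) x)) = 0 := by
    induction hx using Submodule.mul_induction_on' with
    | mem_mul_mem r hr y _ =>
      rw [hword, QuotAlg.proj_of_mem (hRX hr), TensorProduct.zero_tmul]
      rw [← pow_add, cutLen_succ_add hs]
      exact hR hr
    | add a _ b _ ha hb => simp only [map_add, ha, hb, add_zero]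
  refine inclT_injective _ _ ?_
  rw [hG, map_zero]
  induction z using TensorProduct.induction_on with
  | zero => simp
  | tmul a x =>
    rw [dJ_tmul, smul_eq_rTensor_mulLeft, lTensor_rTensor_comm,
      inclT_cutJA, ← smul_eq_rTensor_mulLeft, map_smul, hvanish (J_le_mul_top s R (i + 1) x.2),
      smul_zero]
  | add x y hx hy => rw [map_add, map_add, map_add, hx, hy, add_zero]

/-! ### Decomposition of the multi-Koszul complex -/

namespace RelationSpace

variable {S : Finset ℕ} (P : RelationSpace k V S)

/-- The differential `A ⊗ J_{i+2}^s → A ⊗ J_{i+1}^s` over the multi-homogeneous algebra `A`. -/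
def dAt (s : S) (i : ℕ) : P.Alg ⊗[k] J (s : ℕ) (P.R s) (i + 2) →ₗ[P.Alg]
    P.Alg ⊗[k] J (s : ℕ) (P.R s) (i + 1) :=
  dJ P.relSet (P.two_le s) (P.le_pow s) i

/-- The inclusion `A ⊗ J_i^s → A ⊗ J_i`. -/
def inclAt (s : S) (i : ℕ) : P.Alg ⊗[k] J (s : ℕ) (P.R s) i →ₗ[P.Alg] P.Alg ⊗[k] P.Jsum i :=
  TensorProduct.AlgebraTensorModule.map (LinearMap.id : P.Alg →ₗ[P.Alg] P.Alg)
    (DirectSum.lof k S (fun s : S => J (s : ℕ) (P.R s) i) s)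

/-- The projection `A ⊗ J_i → A ⊗ J_i^s`. -/
def projAt (s : S) (i : ℕ) : P.Alg ⊗[k] P.Jsum i →ₗ[P.Alg] P.Alg ⊗[k] J (s : ℕ) (P.R s) i :=
  TensorProduct.AlgebraTensorModule.map (LinearMap.id : P.Alg →ₗ[P.Alg] P.Alg)
    (DirectSum.component k S (fun s : S => J (s : ℕ) (P.R s) i) s)

theorem projAt_inclAt (s : S) (i : ℕ) (z : P.Alg ⊗[k] J (s : ℕ) (P.R s) i) :
    P.projAt s i (P.inclAt s i z) = z := by
  induction z using TensorProduct.induction_on with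
  | zero => simp
  | tmul a x => simp [projAt, inclAt, DirectSum.component.lof_self]
  | add x y hx hy => rw [map_add, map_add, hx, hy]

theorem projAt_inclAt_of_ne {s t : S} (h : s ≠ t) (i : ℕ)
    (z : P.Alg ⊗[k] J (s : ℕ) (P.R s) i) : P.projAt t i (P.inclAt s i z) = 0 := by
  induction z using TensorProduct.induction_on with
  | zero => simp
  | tmul a x =>
    simp only [projAt, inclAt, TensorProduct.AlgebraTensorModule.map_tmul, DirectSum.component.of,
      dif_neg h, TensorProduct.tmul_zero]
  | add x y hx hy => rw [map_add, map_add, hx, hy, add_zero]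

theorem sum_inclAt_projAt (i : ℕ) (z : P.Alg ⊗[k] P.Jsum i) :
    ∑ s : S, P.inclAt s i (P.projAt s i z) = z := by
  induction z using TensorProduct.induction_on with
  | zero => simp
  | tmul a x =>
    simp only [projAt, inclAt, TensorProduct.AlgebraTensorModule.map_tmul, LinearMap.id_apply,
      ← TensorProduct.tmul_sum]
    congr 1
    exact DirectSum.sum_univ_of x
  | add x y hx hy => simp only [map_add, Finset.sum_add_distrib, hx, hy]

theorem δ₂_inclAt (s : S) (z : P.Alg ⊗[k] J (s : ℕ) (P.R s) 2) :
    P.δ₂ (P.inclAt s 2 z) = P.dAt s 0 z := by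
  induction z using TensorProduct.induction_on with
  | zero => simp; rfl
  | tmul a x =>
    simp only [inclAt, TensorProduct.AlgebraTensorModule.map_tmul, LinearMap.id_apply, δ₂,
      extendLeft_tmul, DirectSum.toModule_lof, dAt, dJ_tmul]
    rfl
  | add x y hx hy => rw [map_add, map_add, map_add, hx, hy]; rfl

theorem δHigh_inclAt (s : S) (i : ℕ) (z : P.Alg ⊗[k] J (s : ℕ) (P.R s) (i + 3)) :
    P.δHigh i (P.inclAt s (i + 3) z) = P.inclAt s (i + 2) (P.dAt s (i + 1) z) := by
  induction z using TensorProduct.induction_on with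
  | zero => simp
  | tmul a x =>
    simp only [inclAt, TensorProduct.AlgebraTensorModule.map_tmul, LinearMap.id_apply, δHigh,
      extendLeft_tmul, DirectSum.toModule_lof, dAt, dJ_tmul, map_smul]
    rfl
  | add x y hx hy => rw [map_add, map_add, map_add, map_add, hx, hy]

theorem projAt_δHigh (s : S) (i : ℕ) (z : P.Alg ⊗[k] P.Jsum (i + 3)) :
    P.projAt s (i + 2) (P.δHigh i z) = P.dAt s (i + 1) (P.projAt s (i + 3) z) := by
  rw [← P.sum_inclAt_projAt (i + 3) z]
  simp only [map_sum, δHigh_inclAt]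
  rw [Finset.sum_eq_single s, Finset.sum_eq_single s]
  · rw [projAt_inclAt, projAt_inclAt]
  · intro t _ hts; rw [projAt_inclAt_of_ne P hts, map_zero]
  · simp
  · intro t _ hts; rw [projAt_inclAt_of_ne P hts]
  · simp

theorem dAt_dAt (s : S) (i : ℕ) (z : P.Alg ⊗[k] J (s : ℕ) (P.R s) (i + 3)) :
    P.dAt s i (P.dAt s (i + 1) z) = 0 :=
  dJ_dJ _ _ (P.subset_relSet s) i z

theorem iSupIndep_relPart : iSupIndep P.relPart := by
  intro s
  rw [Submodule.disjoint_def]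
  rintro _ ⟨w, rfl⟩ hw
  have hle : ⨆ (t) (_ : t ≠ s), P.relPart t ≤ LinearMap.ker (P.projAt s 2) := by
    refine iSup₂_le fun t ht => ?_
    rintro _ ⟨y, rfl⟩
    exact P.projAt_inclAt_of_ne ht 2 y
  have h : P.projAt s 2 (P.inclAt s 2 w) = 0 := hle hw
  rw [projAt_inclAt] at h
  rw [h, map_zero]

/-- The multi-Koszul complex is exact if and only if each of its summands is exact in degrees at
least two and the kernel of the second differential is compatible with the decomposition. -/
theorem isMultiKoszul_iff_exact_dAt :
    P.IsMultiKoszul ↔ (∀ s i, Function.Exact (P.dAt s (i + 1)) (P.dAt s i)) ∧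
      IsDirectSumOf (LinearMap.ker P.δ₂) (fun s : S => LinearMap.ker P.δ₂ ⊓ P.relPart s) := by
  constructor
  · intro h
    refine ⟨fun s i z => ⟨fun hz => ?_, ?_⟩,
      P.iSupIndep_relPart.mono fun s => inf_le_right, le_antisymm ?_ (iSup_le fun s => inf_le_left)⟩
    · have hy : ∃ y, P.δHigh i y = P.inclAt s (i + 2) z := by
        rcases i with _ | i
        · exact (h.exact_two _).1 (by rw [δ₂_inclAt, hz]; rfl)
        · exact (h.exact_add_three i _).1 (by rw [δHigh_inclAt, hz, map_zero])
      obtain ⟨y, hy⟩ := hy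
      exact ⟨P.projAt s (i + 3) y, by rw [← projAt_δHigh, hy, projAt_inclAt]⟩
    · rintro ⟨y, rfl⟩
      exact P.dAt_dAt s i y
    · intro z hz
      obtain ⟨y, rfl⟩ := (h.exact_two _).1 (LinearMap.mem_ker.1 hz)
      rw [← P.sum_inclAt_projAt 3 y, map_sum]
      refine Submodule.sum_mem _ fun s _ => Submodule.mem_iSup_of_mem s ⟨?_, ?_⟩
      · exact (h.exact_two _).2 ⟨_, rfl⟩
      · rw [δHigh_inclAt P s 0]
        exact ⟨_, rfl⟩
  · rintro ⟨h, -, hker⟩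
    refine ⟨aug_surjective _ _, exact_diffOne_aug _, P.exact_δ₂_δ₁, fun z => ⟨fun hz => ?_, ?_⟩,
      fun i z => ⟨fun hz => ?_, ?_⟩⟩
    · have hz' (s : S) : P.dAt s 0 (P.projAt s 2 z) = 0 := by
        have hle : LinearMap.ker P.δ₂ ≤ LinearMap.ker (P.dAt s 0 ∘ₗ P.projAt s 2) := by
          rw [hker]
          refine iSup_le fun t => ?_
          rintro _ ⟨h1, y, rfl⟩
          change P.dAt s 0 (P.projAt s 2 (P.inclAt t 2 y)) = 0
          replace h1 : P.δ₂ (P.inclAt t 2 y) = 0 := h1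
          by_cases hts : t = s
          · subst hts
            rwa [projAt_inclAt, ← δ₂_inclAt]
          · rw [projAt_inclAt_of_ne P hts, map_zero]
        exact hle hz
      choose y hy using fun s => (h s 0 _).1 (hz' s)
      refine ⟨∑ s, P.inclAt s 3 (y s), ?_⟩
      rw [map_sum, ← P.sum_inclAt_projAt 2 z]
      exact Finset.sum_congr rfl fun s _ => by rw [δHigh_inclAt P s 0, hy]
    · rintro ⟨y, rfl⟩
      rw [← P.sum_inclAt_projAt 3 y, map_sum, map_sum]
      exact Finset.sum_eq_zero fun s _ => by rw [δHigh_inclAt P s 0, δ₂_inclAt, dAt_dAt]; rfl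
    · have hz' (s : S) : P.dAt s (i + 1) (P.projAt s (i + 3) z) = 0 := by
        rw [← projAt_δHigh, hz, map_zero]
      choose y hy using fun s => (h s (i + 1) _).1 (hz' s)
      refine ⟨∑ s, P.inclAt s (i + 4) (y s), ?_⟩
      rw [map_sum, ← P.sum_inclAt_projAt (i + 3) z]
      exact Finset.sum_congr rfl fun s _ => by rw [δHigh_inclAt P s (i + 1), hy]
    · rintro ⟨y, rfl⟩
      rw [← P.sum_inclAt_projAt (i + 4) y, map_sum, map_sum]
      exact Finset.sum_eq_zero fun s _ => by
        rw [δHigh_inclAt P s (i + 1), δHigh_inclAt, dAt_dAt, map_zero]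

end RelationSpace

/-- The Koszul complex of a homogeneous algebra is exact as soon as it is exact in degrees at
least two. -/
theorem isHomogeneousKoszul_iff_exact_dJ {s : ℕ} (hs : 2 ≤ s) {R : Submodule k (T k V)}
    (hR : R ≤ V1 k V ^ s) : IsHomogeneousKoszul hs hR ↔
      ∀ i, Function.Exact (dJ (R : Set (T k V)) hs hR (i + 1)) (dJ (R : Set (T k V)) hs hR i) := by
  constructor
  · rintro h (_ | i)
    · exact h.exact_two
    · exact h.exact_add_three i
  · exact fun h => ⟨aug_surjective _ _, exact_diffOne_aug _, exact_homDiffTwo_diffOne hs hR, h 0,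
      fun i => h (i + 1)⟩

/-! ### Kernels of surjections as right modules -/

section RightModule

variable {Q A : Type*} [Ring Q] [Algebra k Q] [Ring A] [Algebra k A] (φ : Q →ₐ[k] A)

/-- The kernel of `φ : Q → A` as a right `Q`-module. -/
def rightKer : Submodule Qᵐᵒᵖ Q where
  carrier := {x | φ x = 0}
  add_mem' {x y} hx hy := by
    rw [Set.mem_ofPred_eq] at *
    rw [map_add, hx, hy, add_zero]
  zero_mem' := map_zero φ
  smul_mem' q x hx := by
    rw [Set.mem_ofPred_eq] at *
    rw [← MulOpposite.op_unop q, op_smul_eq_mul, map_mul, hx, zero_mul]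

/-- A ring is free of rank one as a right module over itself. -/
def selfEquivOp (Q : Type*) [Ring Q] : Q ≃ₗ[Qᵐᵒᵖ] Qᵐᵒᵖ where
  toFun := MulOpposite.op
  invFun := MulOpposite.unop
  map_add' _ _ := rfl
  map_smul' _ _ := rfl

instance free_op_self (Q : Type*) [Ring Q] : Module.Free Qᵐᵒᵖ Q :=
  Module.Free.of_equiv (selfEquivOp Q).symm

variable {M N : Type*} [AddCommGroup M] [Module k M] [Module Q M] [IsScalarTower k Q M]
  [AddCommGroup N] [Module k N] [Module Q N] [IsScalarTower k Q N] {β : Type*}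

/-- The map sending a finitely supported family `(m_i)` to `∑ b_i m_i`. -/
def combine (b : β → Q) : (β →₀ M) →ₗ[k] M :=
  Finsupp.lsum k fun i => Algebra.lsmul k k M (b i)

theorem combine_apply (b : β → Q) (g : β →₀ M) : combine (k := k) b g = g.sum fun i m => b i • m :=
  rfl

theorem combine_single (b : β → Q) (i : β) (m : M) :
    combine (k := k) b (Finsupp.single i m) = b i • m := by
  simp [combine]

theorem map_combine (b : β → Q) (f : M →ₗ[k] N) (hf : ∀ (q : Q) m, f (q • m) = q • f m)
    (g : β →₀ M) : f (combine (k := k) b g) =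
      combine (k := k) b (Finsupp.mapRange.linearMap f g) := by
  induction g using Finsupp.induction_linear with
  | zero => simp
  | add x y hx hy => rw [map_add, map_add, hx, hy, map_add, map_add]
  | single i m => simp [combine_single, hf]

end RightModule

section Transfer

variable {Q A : Type*} [Ring Q] [Algebra k Q] [Ring A] [Algebra k A] {φ : Q →ₐ[k] A}
  {U W Y : Type*} [AddCommGroup U] [Module k U] [AddCommGroup W] [Module k W]
  [AddCommGroup Y] [Module k Y]

/-- The kernel of `φ ⊗ W` is the image of `ker φ ⊗ W`. -/
theorem exists_lift_of_rTensor_eq_zero (hφ : Function.Surjective φ) {z : Q ⊗[k] W}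
    (hz : LinearMap.rTensor W φ.toLinearMap z = 0) :
    ∃ y, LinearMap.rTensor W (LinearMap.ker φ.toLinearMap).subtype y = z :=
  (rTensor_exact W (f := (LinearMap.ker φ.toLinearMap).subtype) (g := φ.toLinearMap)
    (fun x => by simp) hφ z).1 hz

/-- A section of the canonical surjection from a free right module onto the kernel of `φ`, if this
kernel is projective. The kernel is a variable `K` of type `Submodule k Q`, so that `k`-linear
constructions apply to it, and right linearity is spelled out. -/
theorem exists_section_of_projective (h : Module.Projective Qᵐᵒᵖ (rightKer φ)) :
    ∀ K : Submodule k Q, K = LinearMap.ker φ.toLinearMap → ∃ σ : K →ₗ[k] (K →₀ Q),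
      (∀ x, combine (k := k) (fun y : K => (y : Q)) (σ x) = x) ∧
      ∀ (x : K) (q : Q) (hxq : (x : Q) * q ∈ K) (y : K), σ ⟨x * q, hxq⟩ y = σ x y * q := by
  rintro K rfl
  obtain ⟨s, hs⟩ := Module.projective_def'.1 h
  let e : rightKer φ ≃ LinearMap.ker φ.toLinearMap := Equiv.refl _
  have hmul (x : rightKer φ) (q : Q) (hxq : (x : Q) * q ∈ rightKer φ) :
      s ⟨x * q, hxq⟩ = MulOpposite.op q • s x := by
    rw [← map_smul]
    rfl
  refine ⟨{ toFun := fun x => Finsupp.mapRange MulOpposite.unop rfl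
              (Finsupp.equivMapDomain e (s (e.symm x)))
            map_add' := fun x y => ?_
            map_smul' := fun r x => ?_ }, fun x => ?_, fun x q hxq y => ?_⟩
  · ext z
    simp only [Finsupp.mapRange_apply, Finsupp.equivMapDomain_apply, Finsupp.add_apply]
    rw [show e.symm (x + y) = e.symm x + e.symm y from rfl, map_add]
    rfl
  · ext z
    have hr : e.symm (r • x) = MulOpposite.op (algebraMap k Q r) • e.symm x := by
      refine Subtype.ext ?_
      change r • (x : Q) = x * algebraMap k Q r
      rw [Algebra.smul_def, Algebra.commutes]
    simp only [Finsupp.mapRange_apply, Finsupp.equivMapDomain_apply, Finsupp.smul_apply,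
      RingHom.id_apply]
    rw [hr, map_smul, Algebra.smul_def, Algebra.commutes]
    rfl
  · have h1 := congrArg Subtype.val (LinearMap.congr_fun hs (e.symm x))
    change _ = (x : Q) at h1
    refine Eq.trans ?_ h1
    rw [LinearMap.comp_apply, Finsupp.linearCombination_apply, Finsupp.sum, combine_apply]
    change Finsupp.sum (Finsupp.mapRange MulOpposite.unop rfl
      (Finsupp.equivMapDomain e (s (e.symm x)))) _ = _
    rw [Finsupp.sum_mapRange_index (by simp), Finsupp.sum_equivMapDomain, Finsupp.sum,
      AddSubmonoidClass.coe_finsetSum]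
    rfl
  · exact congrArg (fun g : rightKer φ →₀ Qᵐᵒᵖ => (g y).unop) (hmul x q hxq)

/-- If the kernel of `φ : Q → A` is a projective right `Q`-module, then tensoring with this kernel
preserves exactness of `Q ⊗ U → Q ⊗ W → Q ⊗ Y`. -/
theorem exists_lift_of_projective (hφ : Function.Surjective φ)
    (h : Module.Projective Qᵐᵒᵖ (rightKer φ)) (c : W →ₗ[k] Q ⊗[k] Y)
    (d : Q ⊗[k] U →ₗ[Q] Q ⊗[k] W)
    (hd : ∀ z, extendLeft c z = 0 → ∃ u, d u = z) {z : Q ⊗[k] W}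
    (hz : LinearMap.rTensor W φ.toLinearMap z = 0) (hcz : extendLeft c z = 0) :
    ∃ u, LinearMap.rTensor U φ.toLinearMap u = 0 ∧ d u = z := by
  classical
  obtain ⟨K, hK⟩ : ∃ K, K = LinearMap.ker φ.toLinearMap := ⟨_, rfl⟩
  have hKφ (x : K) : φ x = 0 := LinearMap.mem_ker.1 (hK.le x.2)
  obtain ⟨σ, hσ, hσmul⟩ := exists_section_of_projective h K hK
  have hmem (x : K) (q : Q) : (x : Q) * q ∈ K := by
    refine hK.ge ?_
    change φ (x * q) = 0
    rw [map_mul, hKφ, zero_mul]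
  let mulK (x : K) : Q →ₗ[k] K := LinearMap.codRestrict K (LinearMap.mulLeft k (x : Q)) (hmem x)
  -- The differential of `K ⊗ J`, for the right `Q`-module `K`.
  let dK : K ⊗[k] W →ₗ[k] K ⊗[k] Y := TensorProduct.lift
    { toFun := fun x => LinearMap.rTensor Y (mulK x) ∘ₗ c
      map_add' := fun x y => by
        rw [← LinearMap.add_comp, ← LinearMap.rTensor_add]
        congr 2
        ext q
        exact add_mul _ _ _
      map_smul' := fun r x => by
        rw [RingHom.id_apply, ← LinearMap.smul_comp, ← LinearMap.rTensor_smul]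
        congr 2
        ext q
        exact smul_mul_assoc _ _ _ }
  have hdK_tmul (x : K) (w : W) : dK (x ⊗ₜ w) = LinearMap.rTensor Y (mulK x) (c w) := rfl
  have hdK (y : K ⊗[k] W) : LinearMap.rTensor Y K.subtype (dK y) =
      extendLeft c (LinearMap.rTensor W K.subtype y) := by
    induction y using TensorProduct.induction_on with
    | zero => simp
    | tmul x w =>
      rw [hdK_tmul, LinearMap.rTensor_tmul, extendLeft_tmul, smul_eq_rTensor_mulLeft,
        ← LinearMap.rTensor_comp_apply]
      rfl
    | add x y hx hy => simp only [map_add, hx, hy]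
  -- The coordinates of the section are right linear and so commute with the differentials.
  let τ (y : K) : K →ₗ[k] Q := Finsupp.lapply y ∘ₗ σ
  have hτ (y : K) (z : K ⊗[k] W) : extendLeft c (LinearMap.rTensor W (τ y) z) =
      LinearMap.rTensor Y (τ y) (dK z) := by
    induction z using TensorProduct.induction_on with
    | zero => simp
    | tmul x w =>
      rw [hdK_tmul, LinearMap.rTensor_tmul, extendLeft_tmul, smul_eq_rTensor_mulLeft,
        ← LinearMap.rTensor_comp_apply]
      congr 2
      ext q
      exact (hσmul x q (hmem x q) y).symm
    | add x y hx hy => simp only [map_add, hx, hy]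
  have hsum (z : K ⊗[k] W) : ∃ F : Finset K,
      ∑ y ∈ F, (y : Q) • LinearMap.rTensor W (τ y) z = LinearMap.rTensor W K.subtype z := by
    suffices h : ∃ F : Finset K, ∀ F', F ⊆ F' →
        ∑ y ∈ F', (y : Q) • LinearMap.rTensor W (τ y) z = LinearMap.rTensor W K.subtype z from
      ⟨h.choose, h.choose_spec _ le_rfl⟩
    induction z using TensorProduct.induction_on with
    | zero => exact ⟨∅, by simp⟩
    | tmul x w =>
      refine ⟨(σ x).support, fun F' hF' => ?_⟩
      simp only [LinearMap.rTensor_tmul, TensorProduct.smul_tmul', ← TensorProduct.sum_tmul]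
      congr 1
      refine Eq.trans ?_ (hσ x)
      rw [combine_apply, Finsupp.sum_of_support_subset _ hF' _ (by simp)]
      rfl
    | add x y hx hy =>
      obtain ⟨F, hF⟩ := hx
      obtain ⟨G, hG⟩ := hy
      refine ⟨F ∪ G, fun F' hF' => ?_⟩
      simp only [map_add, smul_add, Finset.sum_add_distrib]
      rw [hF _ (Finset.union_subset_left hF'), hG _ (Finset.union_subset_right hF')]
  -- The coordinates of a cycle are cycles over `Q`, hence boundaries `d (u x)`; the cycle is the
  -- boundary of `∑ x • u x`.
  obtain ⟨y, rfl⟩ : ∃ y, LinearMap.rTensor W K.subtype y = z := by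
    subst hK
    exact exists_lift_of_rTensor_eq_zero hφ hz
  have hdKy : dK y = 0 := by
    refine Module.Flat.rTensor_preserves_injective_linearMap (M := Y) K.subtype
      K.injective_subtype ?_
    rw [hdK, map_zero]
    exact hcz
  have hu (x : K) : ∃ u, d u = LinearMap.rTensor W (τ x) y :=
    hd _ (by rw [hτ, hdKy, map_zero])
  choose u hu using hu
  obtain ⟨F, hF⟩ := hsum y
  refine ⟨∑ x ∈ F, (x : Q) • u x, ?_, ?_⟩
  · rw [map_sum]
    refine Finset.sum_eq_zero fun x _ => ?_
    have hx := hKφ x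
    rw [smul_eq_rTensor_mulLeft, ← LinearMap.rTensor_comp_apply]
    have : φ.toLinearMap ∘ₗ LinearMap.mulLeft k (x : Q) = 0 := by
      ext q
      simp [hx]
    rw [this, LinearMap.rTensor_zero, LinearMap.zero_apply]
  · rw [map_sum, ← hF]
    exact Finset.sum_congr rfl fun x _ => by rw [map_smul, hu]

end Transfer

/-- If a homogeneous algebra is Koszul and the kernel of the projection onto a quotient is a
projective right module, then its Koszul complex stays exact in degrees at least two over the
quotient. -/
theorem exact_dJ_of_projective {Y : Set (T k V)} {s : ℕ} (hs : 2 ≤ s) {R : Submodule k (T k V)}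
    (hR : R ≤ V1 k V ^ s) (hRY : (R : Set (T k V)) ⊆ Y)
    (h : Module.Projective (QuotAlg (R : Set (T k V)))ᵐᵒᵖ (rightKer (QuotAlg.map hRY)))
    (hex : ∀ i, Function.Exact (dJ (R : Set (T k V)) hs hR (i + 1)) (dJ (R : Set (T k V)) hs hR i))
    (i : ℕ) : Function.Exact (dJ Y hs hR (i + 1)) (dJ Y hs hR i) := by
  intro z
  refine ⟨fun hz => ?_, ?_⟩
  swap
  · rintro ⟨w, rfl⟩
    exact dJ_dJ hs hR hRY i w
  have hsurj := QuotAlg.map_surjective hRY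
  obtain ⟨x, rfl⟩ := LinearMap.rTensor_surjective (J s R (i + 2))
    (g := (QuotAlg.map hRY).toLinearMap) hsurj z
  have hx : LinearMap.rTensor _ (QuotAlg.map hRY).toLinearMap (dJ _ hs hR i x) = 0 := by
    rw [rTensor_map_dJ, hz]
  -- The kernel of the projection, tensored with the Koszul complex, is exact in degree `i + 1`.
  have hu : ∃ u, LinearMap.rTensor _ (QuotAlg.map hRY).toLinearMap u = 0 ∧
      dJ _ hs hR i u = dJ _ hs hR i x := by
    rcases i with _ | i
    -- In degree one the next term `Q` of the complex is identified with `Q ⊗ k`.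
    · let c : V1 k V →ₗ[k] QuotAlg (R : Set (T k V)) ⊗[k] k :=
        (TensorProduct.rid k _).symm.toLinearMap ∘ₗ
          (QuotAlg.proj (R : Set (T k V))).toLinearMap ∘ₗ (V1 k V).subtype
      have hc (w : QuotAlg (R : Set (T k V)) ⊗[k] V1 k V) :
          extendLeft c w = 0 ↔ diffOne (R : Set (T k V)) w = 0 := by
        have : extendLeft c w = (TensorProduct.rid k _).symm (diffOne (R : Set (T k V)) w) := by
          induction w using TensorProduct.induction_on with
          | zero => simp
          | tmul a v => simp [c, diffOne_tmul, TensorProduct.smul_tmul']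
          | add x y hx hy => simp only [map_add, hx, hy]
        rw [this, LinearEquiv.map_eq_zero_iff]
      exact exists_lift_of_projective hsurj h c (homDiffTwo hs hR)
        (fun w hw => (exact_homDiffTwo_diffOne hs hR w).1 ((hc w).1 hw)) hx
        ((hc _).2 ((exact_homDiffTwo_diffOne hs hR _).2 ⟨x, rfl⟩))
    · exact exists_lift_of_projective hsurj h (cutJA _ hs hR i) (dJ _ hs hR (i + 1))
        (fun w hw => (hex i w).1 hw) hx (dJ_dJ hs hR le_rfl i x)
  obtain ⟨u, hu0, hu⟩ := hu
  obtain ⟨w, hw⟩ := (hex i (x - u)).1 (by rw [map_sub, hu, sub_self])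
  refine ⟨LinearMap.rTensor _ (QuotAlg.map hRY).toLinearMap w, ?_⟩
  rw [← rTensor_map_dJ, hw, map_sub, hu0, sub_zero]

open CategoryTheory in
/-- `A` has projective dimension at most one over `A^s` if and only if the kernel of `A^s → A` is
projective. -/
theorem RelationSpace.hasProjectiveDimensionLE_one_iff {S : Finset ℕ} (P : RelationSpace k V S)
    (s : S) : HasProjectiveDimensionLE (P.rightModule s) 1 ↔
      Module.Projective (P.AlgAt s)ᵐᵒᵖ (rightKer (QuotAlg.map (P.subset_relSet s))) := by
  let g : P.AlgAt s →ₗ[(P.AlgAt s)ᵐᵒᵖ] P.rightModule s :=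
    { toFun := fun a => P.algAtMap s a
      map_add' := fun a b => map_add (P.algAtMap s) a b
      map_smul' := fun q a => map_mul (P.algAtMap s) a q.unop }
  let C : ShortComplex (ModuleCat (P.AlgAt s)ᵐᵒᵖ) :=
    ShortComplex.mk (ModuleCat.ofHom (rightKer (QuotAlg.map (P.subset_relSet s))).subtype)
      (ModuleCat.ofHom g) (by
        ext x
        exact x.2)
  have hC : C.ShortExact :=
    { exact := (ShortComplex.ShortExact.moduleCat_exact_iff_function_exact _).2 fun x =>
        ⟨fun hx => ⟨⟨x, hx⟩, rfl⟩, by rintro ⟨y, rfl⟩; exact y.2⟩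
      mono_f := (ModuleCat.mono_iff_injective _).2 (Submodule.injective_subtype _)
      epi_g := (ModuleCat.epi_iff_surjective _).2 (QuotAlg.map_surjective (P.subset_relSet s)) }
  have hproj : Projective C.X₂ :=
    (IsProjective.iff_projective (P.AlgAt s)).1 Module.Projective.of_free
  exact (hC.hasProjectiveDimensionLT_X₃_iff 0 hproj).trans
    (projective_iff_hasProjectiveDimensionLT_one.symm.trans
      (IsProjective.iff_projective _).symm)

/-! ### Homogeneous generators of the kernel -/

section Coordinates

variable {Q : Type*} [Ring Q] [Algebra k Q] {W ι : Type*} [AddCommGroup W] [Module k W]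

/-- The `i`-th coordinate of an element of the free left module `Q ⊗ W` with respect to a basis
of `W`. -/
def coordAt (b : Module.Basis ι k W) (i : ι) : Q ⊗[k] W →ₗ[Q] Q :=
  extendLeft (Algebra.linearMap k Q ∘ₗ b.coord i)

theorem coordAt_tmul (b : Module.Basis ι k W) (i : ι) (q : Q) (w : W) :
    coordAt b i (q ⊗ₜ[k] w) = b.repr w i • q := by
  rw [coordAt, extendLeft_tmul, LinearMap.comp_apply, Algebra.linearMap_apply, smul_eq_mul,
    ← Algebra.commutes, ← Algebra.smul_def]
  rfl

theorem eq_zero_of_coordAt_eq_zero (b : Module.Basis ι k W) {z : Q ⊗[k] W}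
    (h : ∀ i, coordAt b i z = 0) : z = 0 := by
  classical
  have key (i : ι) (z : Q ⊗[k] W) :
      coordAt b i z = TensorProduct.equivFinsuppOfBasisRight b z i := by
    induction z using TensorProduct.induction_on with
    | zero => simp
    | tmul q w =>
      rw [coordAt_tmul, TensorProduct.equivFinsuppOfBasisRight_apply_tmul_apply]
    | add x y hx hy => rw [map_add, hx, hy, map_add, Finsupp.add_apply]
  refine (TensorProduct.equivFinsuppOfBasisRight b).map_eq_zero_iff.1 ?_
  ext i
  rw [← key, h, Finsupp.zero_apply]

theorem coordAt_rTensor (b : Module.Basis ι k W) (i : ι) (f : Q →ₗ[k] Q) (z : Q ⊗[k] W) :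
    coordAt b i (LinearMap.rTensor W f z) = f (coordAt b i z) := by
  induction z using TensorProduct.induction_on with
  | zero => simp
  | tmul q w => rw [LinearMap.rTensor_tmul, coordAt_tmul, coordAt_tmul, map_smul]
  | add x y hx hy => simp only [map_add, hx, hy]

end Coordinates

theorem exists_sum_rTensor_degPart {X : Set (T k V)} (hX : IsPosHomogeneous X) {W : Type*}
    [AddCommGroup W] [Module k W] (z : QuotAlg X ⊗[k] W) :
    ∃ N, ∀ M, N ≤ M → ∑ n ∈ Finset.range M, LinearMap.rTensor W (degPart hX n) z = z := by
  induction z using TensorProduct.induction_on with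
  | zero => exact ⟨0, by simp⟩
  | tmul q w =>
    obtain ⟨N, hN⟩ := exists_sum_degPart hX q
    exact ⟨N, fun M hM => by
      simp only [LinearMap.rTensor_tmul, ← TensorProduct.sum_tmul, hN M hM]⟩
  | add x y hx hy =>
    obtain ⟨N, hN⟩ := hx
    obtain ⟨N', hN'⟩ := hy
    refine ⟨max N N', fun M hM => ?_⟩
    simp only [map_add, Finset.sum_add_distrib]
    rw [hN M (by omega), hN' M (by omega)]

theorem IsHomogeneousOfDegree.rTensor_degPart_smul {X : Set (T k V)} {hX : IsPosHomogeneous X}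
    {W : Type*} [AddCommGroup W] [Module k W] {d : ℕ} {b : QuotAlg X}
    (hb : IsHomogeneousOfDegree hX d b) (n : ℕ) (z : QuotAlg X ⊗[k] W) :
    LinearMap.rTensor W (MultiKoszul.degPart hX n) (b • z) =
      if d ≤ n then b • LinearMap.rTensor W (MultiKoszul.degPart hX (n - d)) z else 0 := by
  rw [smul_eq_rTensor_mulLeft, smul_eq_rTensor_mulLeft, ← LinearMap.rTensor_comp_apply,
    ← LinearMap.rTensor_comp_apply]
  split_ifs with h
  · congr 2
    ext a
    simp [hb.degPart_mul, h]
  · rw [show MultiKoszul.degPart hX n ∘ₗ LinearMap.mulLeft k b = 0 by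
      ext a
      simp [hb.degPart_mul, h], LinearMap.rTensor_zero, LinearMap.zero_apply]

/-- The image of `V` in `T(V)/⟨X⟩`. -/
abbrev lettersOf (X : Set (T k V)) : Submodule k (QuotAlg X) :=
  (V1 k V).map (QuotAlg.proj X).toLinearMap

/-- The kernel of the canonical morphism `T(V)/⟨X⟩ → T(V)/⟨Y⟩`, as a subspace. -/
abbrev mapKer {X Y : Set (T k V)} (h : X ⊆ Y) : Submodule k (QuotAlg X) :=
  LinearMap.ker (QuotAlg.map h).toLinearMap

theorem degPart_mem_mapKer {X Y : Set (T k V)} (h : X ⊆ Y) (hX : IsPosHomogeneous X)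
    (hY : IsPosHomogeneous Y) (n : ℕ) {x : QuotAlg X} (hx : x ∈ mapKer h) :
    degPart hX n x ∈ mapKer h := by
  have hx' : QuotAlg.map h x = 0 := hx
  change QuotAlg.map h (degPart hX n x) = 0
  rw [map_degPart h hX hY, hx', map_zero]

theorem degPart_zero_of_mem_mapKer {X Y : Set (T k V)} (h : X ⊆ Y) (hX : IsPosHomogeneous X)
    (hY : IsPosHomogeneous Y) {x : QuotAlg X} (hx : x ∈ mapKer h) : degPart hX 0 x = 0 := by
  have hmem : QuotAlg.map h (degPart hX 0 x) = 0 := degPart_mem_mapKer h hX hY 0 hx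
  rw [degPart_zero, AlgHom.commutes] at hmem
  have := congrArg (QuotAlg.aug Y hY.algebraMapInv_eq_zero) hmem
  rw [AlgHom.commutes, map_zero] at this
  rw [degPart_zero, show QuotAlg.aug X hX.algebraMapInv_eq_zero x = 0 from this, map_zero]

/-- `B` is a minimal system of homogeneous generators of the right ideal `ker (T(V)/⟨X⟩ → T(V)/⟨Y⟩)`:
its elements are homogeneous of positive degree and form a basis of the kernel `K` modulo `K V`. -/
structure IsMinimalGenerators {X Y : Set (T k V)} (h : X ⊆ Y) (hX : IsPosHomogeneous X)
    (B : Set (QuotAlg X)) : Prop where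
  mem_mapKer : ∀ b ∈ B, b ∈ mapKer h
  homogeneous : ∀ b ∈ B, ∃ d, 1 ≤ d ∧ IsHomogeneousOfDegree hX d b
  linearIndepOn : LinearIndepOn k (mapKer h * lettersOf X).mkQ B
  le_span_sup : mapKer h ≤ Submodule.span k B ⊔ mapKer h * lettersOf X

theorem exists_isMinimalGenerators {X Y : Set (T k V)} (h : X ⊆ Y) (hX : IsPosHomogeneous X)
    (hY : IsPosHomogeneous Y) : ∃ B, IsMinimalGenerators h hX B := by
  obtain ⟨B, hBt, -, htB, hB⟩ := exists_linearIndepOn_extension (K := k)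
    (v := (mapKer h * lettersOf X).mkQ) (s := ∅)
    (t := {b | b ∈ mapKer h ∧ ∃ d, 1 ≤ d ∧ IsHomogeneousOfDegree hX d b})
    (linearIndepOn_empty _ _) (Set.empty_subset _)
  refine ⟨B, fun b hb => (hBt hb).1, fun b hb => (hBt hb).2, hB, fun x hx => ?_⟩
  obtain ⟨N, hN⟩ := exists_sum_degPart hX x
  rw [← hN N le_rfl]
  refine Submodule.sum_mem _ fun n _ => ?_
  rcases Nat.eq_zero_or_pos n with rfl | hn
  · rw [degPart_zero_of_mem_mapKer h hX hY hx]
    exact zero_mem _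
  · have hmem : (mapKer h * lettersOf X).mkQ (degPart hX n x) ∈
        (Submodule.span k B).map (mapKer h * lettersOf X).mkQ := by
      rw [Submodule.map_span]
      exact htB ⟨_, ⟨degPart_mem_mapKer h hX hY n hx, n, hn, isHomogeneousOfDegree_degPart hX n x⟩,
        rfl⟩
    have := Submodule.mem_comap.2 hmem
    rwa [Submodule.comap_map_mkQ, sup_comm] at this

namespace IsMinimalGenerators

variable {X Y : Set (T k V)} {h : X ⊆ Y} {hX : IsPosHomogeneous X} {B : Set (QuotAlg X)}

/-- Minimal generators generate the kernel as a right ideal, by induction on the degree. -/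
theorem mapKer_le_range_combine (hB : IsMinimalGenerators h hX B) (hY : IsPosHomogeneous Y) :
    mapKer h ≤ LinearMap.range
      (combine (k := k) (M := QuotAlg X) (fun b : B => (b : QuotAlg X))) := by
  set G := LinearMap.range (combine (k := k) (M := QuotAlg X) (fun b : B => (b : QuotAlg X)))
  have hmul {x : QuotAlg X} (hx : x ∈ G) (q : QuotAlg X) : x * q ∈ G := by
    obtain ⟨g, rfl⟩ := hx
    exact ⟨_, (map_combine _ (LinearMap.mulRight k q) (fun a m => mul_assoc a m q) g).symm⟩
  have hBG : Submodule.span k B ≤ G := Submodule.span_le.2 fun b hb =>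
    ⟨Finsupp.single ⟨b, hb⟩ 1, by rw [combine_single, smul_eq_mul, mul_one]⟩
  have key (n : ℕ) : ∀ x ∈ mapKer h, degPart hX n x ∈ G := by
    induction n using Nat.strong_induction_on with
    | _ n ih =>
      intro x hx
      have h1 : Submodule.span k B ≤ G.comap (degPart hX n) := Submodule.span_le.2 fun b hb => by
        obtain ⟨d, -, hd⟩ := hB.homogeneous b hb
        rw [SetLike.mem_coe, Submodule.mem_comap, hd.degPart]
        split_ifs
        · exact hBG (Submodule.subset_span hb)
        · exact zero_mem _
      have h2 : mapKer h * lettersOf X ≤ G.comap (degPart hX n) := Submodule.mul_le.2 (by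
        rintro y hy _ ⟨t, ht, rfl⟩
        rw [Submodule.mem_comap]
        have ht1 : t ∈ V1 k V ^ 1 := by rwa [pow_one]
        rcases n with _ | n
        · have h0 := degPart_mul_proj_of_lt hX ht1 Nat.zero_lt_one y
          exact h0 ▸ zero_mem G
        · have h0 := degPart_mul_proj hX ht1 n y
          exact h0 ▸ hmul (ih n (Nat.lt_succ_self n) y hy) _)
      have hsup := sup_le h1 h2 (hB.le_span_sup (degPart_mem_mapKer h hX hY n hx))
      rwa [Submodule.mem_comap, degPart_degPart, if_pos rfl] at hsup
  intro x hx
  obtain ⟨N, hN⟩ := exists_sum_degPart hX x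
  rw [← hN N le_rfl]
  exact Submodule.sum_mem _ fun n _ => key n x hx

theorem combine_mem_mapKer (hB : IsMinimalGenerators h hX B) (g : B →₀ QuotAlg X) :
    combine (k := k) (fun b : B => (b : QuotAlg X)) g ∈ mapKer h := by
  rw [combine_apply]
  refine Submodule.sum_mem _ fun b _ => ?_
  have hb : QuotAlg.map h b = 0 := hB.mem_mapKer b b.2
  change QuotAlg.map h (b * g b) = 0
  rw [map_mul, hb, zero_mul]

variable {W : Type*} [AddCommGroup W] [Module k W]

theorem exists_combine_eq (hB : IsMinimalGenerators h hX B) (hY : IsPosHomogeneous Y)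
    {z : QuotAlg X ⊗[k] W} (hz : LinearMap.rTensor W (QuotAlg.map h).toLinearMap z = 0) :
    ∃ g, combine (k := k) (fun b : B => (b : QuotAlg X)) g = z := by
  obtain ⟨y, rfl⟩ := exists_lift_of_rTensor_eq_zero (QuotAlg.map_surjective h) hz
  clear hz
  change _ ∈ LinearMap.range (combine (k := k) (fun b : B => (b : QuotAlg X)))
  induction y using TensorProduct.induction_on with
  | zero => simp
  | tmul x w =>
    obtain ⟨g, hg⟩ := hB.mapKer_le_range_combine hY x.2
    have := map_combine (fun b : B => (b : QuotAlg X)) ((TensorProduct.mk k (QuotAlg X) W).flip w)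
      (fun _ _ => rfl) g
    rw [hg] at this
    exact ⟨_, this.symm⟩
  | add x y hx hy => rw [map_add]; exact add_mem hx hy

theorem rTensor_map_combine (hB : IsMinimalGenerators h hX B) (g : B →₀ QuotAlg X ⊗[k] W) :
    LinearMap.rTensor W (QuotAlg.map h).toLinearMap
      (combine (k := k) (fun b : B => (b : QuotAlg X)) g) = 0 := by
  rw [combine_apply, Finsupp.sum, map_sum]
  refine Finset.sum_eq_zero fun b _ => ?_
  have hb : QuotAlg.map h b = 0 := hB.mem_mapKer b b.2
  rw [smul_eq_rTensor_mulLeft, ← LinearMap.rTensor_comp_apply,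
    show (QuotAlg.map h).toLinearMap ∘ₗ LinearMap.mulLeft k (b : QuotAlg X) = 0 by
      ext q
      simp [hb], LinearMap.rTensor_zero, LinearMap.zero_apply]

/-- If multiplication `K ⊗ V → K` has no more kernel than the relations of `T(V)/⟨X⟩` force, that
is, if `Tor₁(K, k) = 0` for the right module `K = ker (T(V)/⟨X⟩ → T(V)/⟨Y⟩)`, then minimal
generators of `K` are linearly independent over `T(V)/⟨X⟩`. The coefficients of a linear relation
vanish in degrees less than `n`, by induction on `n`: by minimality they have no constant term, and
splitting off their last letters produces a linear relation for each letter. -/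
theorem eq_zero_of_combine_eq_zero (hB : IsMinimalGenerators h hX B) (hY : IsPosHomogeneous Y)
    {U : Type*} [AddCommGroup U] [Module k U]
    (d : QuotAlg X ⊗[k] U →ₗ[QuotAlg X] QuotAlg X ⊗[k] V1 k V) (hd : ∀ y, diffOne X (d y) = 0)
    (hTor : ∀ z, LinearMap.rTensor _ (QuotAlg.map h).toLinearMap z = 0 → diffOne X z = 0 →
      ∃ y, LinearMap.rTensor _ (QuotAlg.map h).toLinearMap y = 0 ∧ d y = z)
    {a : B →₀ QuotAlg X} (ha : combine (k := k) (fun b : B => (b : QuotAlg X)) a = 0) : a = 0 := by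
  let ε := QuotAlg.aug X hX.algebraMapInv_eq_zero
  let μ : QuotAlg X ⊗[k] V1 k V →ₗ[k] QuotAlg X := (diffOne X).restrictScalars k
  have hμ (q : QuotAlg X) (m) : μ (q • m) = q • μ m := map_smul (diffOne X) q m
  -- A linear way of splitting off the last letter of the elements without constant term.
  obtain ⟨σ, hσ⟩ : ∃ σ : QuotAlg X →ₗ[k] QuotAlg X ⊗[k] V1 k V,
      ∀ a, μ (σ a) = a - algebraMap k _ (ε a) := by
    obtain ⟨r, hr⟩ := μ.rangeRestrict.exists_rightInverse_of_surjective μ.range_rangeRestrict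
    let f : QuotAlg X →ₗ[k] LinearMap.range μ :=
      LinearMap.codRestrict _ (LinearMap.id - Algebra.linearMap k _ ∘ₗ ε.toLinearMap)
        (fun a => exists_diffOne_eq_sub_aug hX.algebraMapInv_eq_zero a)
    exact ⟨r ∘ₗ f, fun a => congrArg Subtype.val (LinearMap.congr_fun hr (f a))⟩
  have hμmem (m : QuotAlg X ⊗[k] V1 k V) {b : QuotAlg X} (hb : b ∈ mapKer h) :
      b * μ m ∈ mapKer h * lettersOf X := by
    induction m using TensorProduct.induction_on with
    | zero => simp
    | tmul q v =>
      change b * diffOne X (q ⊗ₜ v) ∈ _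
      have hb' : QuotAlg.map h b = 0 := hb
      rw [diffOne_tmul, ← mul_assoc]
      refine Submodule.mul_mem_mul ?_ ⟨v, v.2, rfl⟩
      change QuotAlg.map h (b * q) = 0
      rw [map_mul, hb', zero_mul]
    | add x y hx hy => rw [map_add, mul_add]; exact add_mem hx hy
  have key (n : ℕ) : ∀ a : B →₀ QuotAlg X,
      combine (k := k) (fun b : B => (b : QuotAlg X)) a = 0 →
        ∀ j < n, ∀ b, degPart hX j (a b) = 0 := by
    induction n with
    | zero => intro a _ j hj; omega
    | succ n ih =>
      intro a ha j hj b
      -- By minimality the constant terms of the coefficients vanish.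
      have hsplit : Finsupp.linearCombination k (fun b : B => (b : QuotAlg X))
          (Finsupp.mapRange.linearMap ε.toLinearMap a) +
          combine (k := k) (fun b : B => (b : QuotAlg X))
            (Finsupp.mapRange.linearMap (μ ∘ₗ σ) a) = 0 := by
        rw [← ha]
        clear ha
        induction a using Finsupp.induction_linear with
        | zero => simp
        | add x y hx hy => rw [map_add, map_add, map_add, map_add, map_add, ← hx, ← hy]; abel
        | single b q =>
          simp only [Finsupp.mapRange.linearMap_apply, Finsupp.mapRange_single,
            Finsupp.linearCombination_single, combine_single, LinearMap.comp_apply, hσ,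
            smul_eq_mul, mul_sub, AlgHom.toLinearMap_apply]
          rw [← Algebra.commutes, ← Algebra.smul_def]
          abel
      have hconst : Finsupp.mapRange.linearMap ε.toLinearMap a = 0 := by
        refine linearIndependent_iff.1 hB.linearIndepOn _ ?_
        have hmk := Finsupp.apply_linearCombination k (mapKer h * lettersOf X).mkQ
          (fun b : B => (b : QuotAlg X)) (Finsupp.mapRange.linearMap ε.toLinearMap a)
        refine hmk.symm.trans ?_
        rw [Submodule.mkQ_apply, Submodule.Quotient.mk_eq_zero, eq_neg_of_add_eq_zero_left hsplit,
          combine_apply]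
        refine neg_mem (Submodule.sum_mem _ fun b _ => ?_)
        exact hμmem _ (hB.mem_mapKer b b.2)
      let w := Finsupp.mapRange.linearMap σ a
      have hw (b : B) : μ (w b) = a b := by
        have hb : ε (a b) = 0 := DFunLike.congr_fun hconst b
        change μ (σ (a b)) = a b
        rw [hσ, hb, map_zero, sub_zero]
      have hw' : Finsupp.mapRange.linearMap μ w = a := Finsupp.ext hw
      -- `∑ b • w b` is killed by multiplication, so it comes from relations; correcting `w` by these
      -- yields `w'` with the same products `a b` and with `∑ b • w' b = 0`.
      obtain ⟨y, hy, hyw⟩ := hTor (combine (k := k) (fun b : B => (b : QuotAlg X)) w)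
        (hB.rTensor_map_combine w) (by
          have := map_combine (fun b : B => (b : QuotAlg X)) μ hμ w
          rw [hw', ha] at this
          exact this)
      obtain ⟨g, rfl⟩ := hB.exists_combine_eq hY hy
      let w' := w - Finsupp.mapRange.linearMap (d.restrictScalars k) g
      have hw'0 : combine (k := k) (fun b : B => (b : QuotAlg X)) w' = 0 := by
        have := map_combine (fun b : B => (b : QuotAlg X)) (d.restrictScalars k)
          (fun q m => map_smul d q m) g
        rw [map_sub, ← this, ← hyw]
        exact sub_self _
      have hμw' : μ (w' b) = a b := by
        change μ (w b - d (g b)) = a b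
        rw [map_sub, hw, show μ (d (g b)) = 0 from hd _, sub_zero]
      rw [← hμw']
      rcases j with _ | j
      · exact degPart_zero_diffOne hX _
      · have hzero : LinearMap.rTensor _ (degPart hX j) (w' b) = 0 := by
          -- The coordinates of `w'` are linear relations, to which the induction hypothesis applies.
          let e := Module.Basis.ofVectorSpace k (V1 k V)
          refine eq_zero_of_coordAt_eq_zero e fun i => ?_
          rw [coordAt_rTensor]
          have hcoord := map_combine (fun b : B => (b : QuotAlg X))
            ((coordAt e i).restrictScalars k) (fun q m => map_smul (coordAt e i) q m) w'
          rw [hw'0, map_zero] at hcoord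
          exact ih _ hcoord.symm j (by omega) b
        exact (degPart_succ_diffOne hX j _).trans (by rw [hzero, map_zero])
  ext b
  obtain ⟨N, hN⟩ := exists_sum_degPart hX (a b)
  rw [Finsupp.zero_apply, ← hN N le_rfl]
  exact Finset.sum_eq_zero fun j hj => key N a ha j (Finset.mem_range.1 hj) b

/-- Linear independence persists after tensoring with a vector space. -/
theorem eq_zero_of_combine_tensor_eq_zero
    (hinj : ∀ a : B →₀ QuotAlg X, combine (k := k) (fun b : B => (b : QuotAlg X)) a = 0 → a = 0)
    {g : B →₀ QuotAlg X ⊗[k] W} (hg : combine (k := k) (fun b : B => (b : QuotAlg X)) g = 0) :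
    g = 0 := by
  let e := Module.Basis.ofVectorSpace k W
  ext b
  refine eq_zero_of_coordAt_eq_zero e fun i => ?_
  have hcoord := map_combine (fun b : B => (b : QuotAlg X)) ((coordAt e i).restrictScalars k)
    (fun q m => map_smul (coordAt e i) q m) g
  rw [hg, map_zero] at hcoord
  exact DFunLike.congr_fun (hinj _ hcoord.symm) b

/-- The kernel is a free right module if its minimal generators are linearly independent. -/
theorem projective_rightKer (hB : IsMinimalGenerators h hX B) (hY : IsPosHomogeneous Y)
    (hinj : ∀ a : B →₀ QuotAlg X, combine (k := k) (fun b : B => (b : QuotAlg X)) a = 0 → a = 0) :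
    Module.Projective (QuotAlg X)ᵐᵒᵖ (rightKer (QuotAlg.map h)) := by
  let f : (B →₀ QuotAlg X) →ₗ[(QuotAlg X)ᵐᵒᵖ] rightKer (QuotAlg.map h) :=
    { toFun := fun g => ⟨combine (k := k) (fun b : B => (b : QuotAlg X)) g,
        hB.combine_mem_mapKer g⟩
      map_add' := fun x y => Subtype.ext (map_add _ x y)
      map_smul' := fun q g => Subtype.ext
        (map_combine _ (LinearMap.mulRight k q.unop) (fun a m => mul_assoc a m q.unop) g).symm }
  have hf : Function.Bijective f := by
    refine ⟨(injective_iff_map_eq_zero f).2 fun a ha => hinj a (congrArg Subtype.val ha),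
      fun x => ?_⟩
    obtain ⟨g, hg⟩ := hB.mapKer_le_range_combine hY x.2
    exact ⟨g, Subtype.ext hg⟩
  exact Module.Projective.of_equiv (LinearEquiv.ofBijective f hf)

/-- If the kernel of `T(V)/⟨X⟩ → T(V)/⟨Y⟩` is free on `B`, then exactness over `T(V)/⟨Y⟩` implies
exactness over `T(V)/⟨X⟩`. Up to a boundary, a cycle is a combination of cycles with coefficients in
`B`, which have positive degree; so its homogeneous components are boundaries, by induction on the
degree. -/
theorem exists_dJ_eq (hB : IsMinimalGenerators h hX B) (hY : IsPosHomogeneous Y)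
    (hinj : ∀ a : B →₀ QuotAlg X, combine (k := k) (fun b : B => (b : QuotAlg X)) a = 0 → a = 0)
    {s : ℕ} (hs : 2 ≤ s) {R : Submodule k (T k V)} (hR : R ≤ V1 k V ^ s)
    (hRX : (R : Set (T k V)) ⊆ X) (i : ℕ)
    (hex : Function.Exact (dJ Y hs hR (i + 1)) (dJ Y hs hR i))
    {z : QuotAlg X ⊗[k] J s R (i + 2)} (hz : dJ X hs hR i z = 0) :
    z ∈ LinearMap.range (dJ X hs hR (i + 1)) := by
  have key (n : ℕ) : ∀ z : QuotAlg X ⊗[k] J s R (i + 2), dJ X hs hR i z = 0 →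
      LinearMap.rTensor _ (degPart hX n) z ∈ LinearMap.range (dJ X hs hR (i + 1)) := by
    induction n using Nat.strong_induction_on with
    | _ n ih =>
      intro z hz
      obtain ⟨w, hw⟩ := (hex (LinearMap.rTensor _ (QuotAlg.map h).toLinearMap z)).1
        (by rw [← rTensor_map_dJ, hz, map_zero])
      obtain ⟨w, rfl⟩ := LinearMap.rTensor_surjective (J s R (i + 3))
        (g := (QuotAlg.map h).toLinearMap) (QuotAlg.map_surjective h) w
      obtain ⟨g, hg⟩ := hB.exists_combine_eq hY (z := z - dJ X hs hR (i + 1) w)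
        (by rw [map_sub, rTensor_map_dJ, hw, sub_self])
      have hcycle (b : B) : dJ X hs hR i (g b) = 0 := by
        have hzero : Finsupp.mapRange.linearMap ((dJ X hs hR i).restrictScalars k) g = 0 := by
          refine eq_zero_of_combine_tensor_eq_zero hinj ?_
          rw [← map_combine _ ((dJ X hs hR i).restrictScalars k)
            (fun q m => map_smul (dJ X hs hR i) q m), hg]
          change dJ X hs hR i (z - dJ X hs hR (i + 1) w) = 0
          rw [map_sub, hz, dJ_dJ hs hR hRX, sub_zero]
        exact DFunLike.congr_fun hzero b
      rw [show z = dJ X hs hR (i + 1) w + combine (k := k) (fun b : B => (b : QuotAlg X)) g by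
        rw [hg]; abel, map_add]
      refine add_mem ?_ ?_
      · by_cases hn : n < cutLen s (i + 3)
        · rw [rTensor_degPart_dJ_of_lt hX hs hR (i + 1) hn]
          exact zero_mem _
        · obtain ⟨m, rfl⟩ := Nat.exists_eq_add_of_le' (not_lt.1 hn)
          rw [rTensor_degPart_dJ hX hs hR (i + 1)]
          exact ⟨_, rfl⟩
      · rw [combine_apply, Finsupp.sum, map_sum]
        refine Submodule.sum_mem _ fun b _ => ?_
        obtain ⟨d, hd1, hd⟩ := hB.homogeneous b b.2
        rw [hd.rTensor_degPart_smul]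
        split_ifs with hdn
        · exact Submodule.smul_mem _ _ (ih _ (by omega) _ (hcycle b))
        · exact zero_mem _
  obtain ⟨N, hN⟩ := exists_sum_rTensor_degPart hX z
  rw [← hN N le_rfl]
  exact Submodule.sum_mem _ fun n _ => key n z hz

end IsMinimalGenerators

/-- If the Koszul complex of a homogeneous algebra becomes exact in degrees at least two over a
quotient, then it is itself exact in these degrees, and the kernel of the projection onto the
quotient is a projective right module. -/
theorem projective_and_exact_dJ {Y : Set (T k V)} (hY : IsPosHomogeneous Y) {s : ℕ} (hs : 2 ≤ s)
    {R : Submodule k (T k V)} (hR : R ≤ V1 k V ^ s) (hRY : (R : Set (T k V)) ⊆ Y)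
    (hex : ∀ i, Function.Exact (dJ Y hs hR (i + 1)) (dJ Y hs hR i)) :
    Module.Projective (QuotAlg (R : Set (T k V)))ᵐᵒᵖ (rightKer (QuotAlg.map hRY)) ∧
      ∀ i, Function.Exact (dJ (R : Set (T k V)) hs hR (i + 1)) (dJ (R : Set (T k V)) hs hR i) := by
  have hX := isPosHomogeneous_of_le hs hR
  obtain ⟨B, hB⟩ := exists_isMinimalGenerators hRY hX hY
  -- A lift of a cycle to `Q ⊗ R` is corrected by a boundary to lie in `K ⊗ R`.
  have hTor (z : QuotAlg (R : Set (T k V)) ⊗[k] V1 k V)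
      (hz : LinearMap.rTensor _ (QuotAlg.map hRY).toLinearMap z = 0)
      (hz1 : diffOne (R : Set (T k V)) z = 0) :
      ∃ y, LinearMap.rTensor _ (QuotAlg.map hRY).toLinearMap y = 0 ∧ homDiffTwo hs hR y = z := by
    obtain ⟨y, rfl⟩ := (exact_homDiffTwo_diffOne hs hR z).1 hz1
    obtain ⟨w, hw⟩ := (hex 0 (LinearMap.rTensor _ (QuotAlg.map hRY).toLinearMap y)).1
      ((rTensor_map_dJ hRY hs hR 0 y).symm.trans hz)
    obtain ⟨w, rfl⟩ := LinearMap.rTensor_surjective (J s R 3)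
      (g := (QuotAlg.map hRY).toLinearMap) (QuotAlg.map_surjective hRY) w
    refine ⟨y - dJ _ hs hR 1 w, ?_, ?_⟩
    · rw [map_sub, rTensor_map_dJ, ← hw, sub_self]
    · rw [map_sub, show homDiffTwo hs hR (dJ _ hs hR 1 w) = 0 from dJ_dJ hs hR le_rfl 0 w, sub_zero]
  have hinj (a : B →₀ QuotAlg (R : Set (T k V)))
      (ha : combine (k := k) (fun b : B => (b : QuotAlg (R : Set (T k V)))) a = 0) : a = 0 :=
    hB.eq_zero_of_combine_eq_zero hY (homDiffTwo hs hR)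
      (fun y => (exact_homDiffTwo_diffOne hs hR _).2 ⟨y, rfl⟩) hTor ha
  refine ⟨hB.projective_rightKer hY hinj, fun i z => ⟨fun hz => ?_, ?_⟩⟩
  · exact hB.exists_dJ_eq hY hinj hs hR le_rfl i (hex i) hz
  · rintro ⟨w, rfl⟩
    exact dJ_dJ hs hR le_rfl i w

end MultiKoszul

end

theorem mainTheorem1 {k : Type*} [Field k] {V : Type*} [AddCommGroup V] [Module k V]
    [FiniteDimensional k V] {S : Finset ℕ} (P : MultiKoszul.RelationSpace k V S) :
    P.IsMultiKoszul ↔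
      (∀ s : S, MultiKoszul.IsHomogeneousKoszul (P.two_le s) (P.le_pow s)) ∧
      (∀ s : S, CategoryTheory.HasProjectiveDimensionLE (P.rightModule s) 1) ∧
      MultiKoszul.IsDirectSumOf (LinearMap.ker P.δ₂)
        (fun s : S => LinearMap.ker P.δ₂ ⊓ P.relPart s) := by
  rw [P.isMultiKoszul_iff_exact_dAt, ← and_assoc]
  refine and_congr_left fun _ => ⟨fun h => ?_, fun h s => ?_⟩
  · have key (s : S) := MultiKoszul.projective_and_exact_dJ P.isPosHomogeneous_relSet (P.two_le s)
      (P.le_pow s) (P.subset_relSet s) (h s)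
    exact ⟨fun s => (MultiKoszul.isHomogeneousKoszul_iff_exact_dJ _ _).2 (key s).2,
      fun s => (P.hasProjectiveDimensionLE_one_iff s).2 (key s).1⟩
  · exact MultiKoszul.exact_dJ_of_projective (P.two_le s) (P.le_pow s) (P.subset_relSet s)
      ((P.hasProjectiveDimensionLE_one_iff s).1 (h.2 s))
      ((MultiKoszul.isHomogeneousKoszul_iff_exact_dJ _ _).1 (h.1 s))
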